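/- Let $\mathbb K$ be a non-archimedean local field with ring of integers $\mathcal O$, uniformizer $\varpi$ and residue field of cardinality $q$. Let $\mathfrak g$ be a finite-dimensional nilpotent $\mathbb K$-Lie algebra with a positive grading $\mathfrak g=\bigoplus_{k=1}^{s}V_k$, $[V_i,V_j]\subseteq V_{i+j}$ (with $V_k=0$ for $k>s$), and let $Q=\sum_k k\dim V_k$ be its homogeneous dimension. Assume that the integers $1,\dots,c$, where $c$ is the nilpotency class of $\mathfrak g$, are non-zero in $\mathbb K$ (this is automatic in characteristic $0$). Let $G$ be the graded $\mathbb K$-Lie group of $\mathfrak g$: a topological group with a homeomorphism $\exp:\mathfrak g\to G$ such that $\exp X\exp Y=\exp(X\diamond Y)$, where $\diamond$ is the Baker–Campbell–Hausdorff product. Let $X_1,\dots,X_d$ be a basis of $\mathfrak g$ with $X_i\in V_{\nu_i}$, let $D_\gamma$ be the dilations $D_\gamma X_i=\gamma^{\nu_i}X_i$, and put $$G_n=\exp\big(D_{\varpi^n}(\mathcal O X_1+\dots+\mathcal O X_d)\big),\qquad n\in\mathbb Z.$$ Let $dx$ be a Haar measure on $G$, write $|A|$ for the measure of $A$, and let $|x|=|G_n|^{1/Q}$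 for $x\in G_n\setminus G_{n+1}$ and $|e|=0$. For $\beta\in\mathbb R$ let $L^r_\beta(G)=L^r(G,|x|^\beta dx)$ (real- or complex-valued functions), and call a function radial if it is almost everywhere a function of $|x|$. Let $1<r<\infty$, $\frac1r+\frac1{r'}=1$, $0\le\delta<Q$ and $-\infty<\alpha<(r-1)Q-\delta r$. Then every $f\in L^r_{\alpha+\delta r}(G)$ is integrable on the balls $\{t:|t|\le|x|\}$, $x\in G$, and the fractional Hardy operator $$H_\delta f(x)=\frac1{|x|^{Q-\delta}}\int_{|t|\le|x|}f(t)\,dt,\qquad x\in G\setminus\{e\},$$ is a bounded linear operator from $L^r_{\alpha+\delta r}(G)$ to $L^r_\alpha(G)$. Its norm equals the norm of its restriction to the subspace of radial functions of $L^r_{\alpha+\delta r}(G)$, and $$\|H_\delta\|_{\mathcal L(L^r_{\alpha+\delta r}(G),L^r_\alpha(G))}=\frac{1-q^{-Q}}{1-q^{\frac{\alpha}{r}-\frac{Q}{r'}+\delta}}.$$ -/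

import Mathlib

open MeasureTheory ValuativeRel
open scoped ENNReal

/-- A positive grading `𝔤 = V₁ ⊕ ⋯ ⊕ V_s` of a Lie algebra, `⁅V i, V j⁆ ⊆ V (i + j)`,
where `V k` is zero unless `1 ≤ k ≤ s`. -/
structure LieGrading (K 𝔤 : Type*) [Field K] [LieRing 𝔤] [LieAlgebra K 𝔤] where
  step : ℕ
  V : ℕ → Submodule K 𝔤
  eq_bot : ∀ k, k ∉ Finset.Icc 1 step → V k = ⊥
  isInternal : DirectSum.IsInternal V
  lie_mem : ∀ i j, ∀ x ∈ V i, ∀ y ∈ V j, ⁅x, y⁆ ∈ V (i + j)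

/-- The homogeneous dimension `∑ k, k * dim V_k`. -/
noncomputable def LieGrading.homogeneousDim {K 𝔤 : Type*} [Field K] [LieRing 𝔤] [LieAlgebra K 𝔤]
    (𝒱 : LieGrading K 𝔤) : ℕ :=
  ∑ k ∈ Finset.Icc 1 𝒱.step, k * Module.finrank K (𝒱.V k)

/-- The right-nested bracket `⁅z₁, ⁅z₂, … ⁅z_{m-1}, z_m⁆⁆⁆` of a word `z₁ ⋯ z_m`. -/
def nestedBracket {𝔤 : Type*} [LieRing 𝔤] : List 𝔤 → 𝔤
  | [] => 0
  | [z] => z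
  | z :: w :: l => ⁅z, nestedBracket (w :: l)⁆

/-- The Baker–Campbell–Hausdorff product `X ⋄ Y = log (exp X exp Y) = X + Y + ½⁅X, Y⁆ + ⋯` of a
nilpotent Lie algebra, by Dynkin's formula: the sum, over `n ≥ 1` and over the `n`-tuples of pairs
`(rᵢ, sᵢ)` of natural numbers with `rᵢ + sᵢ > 0`, of
`(-1)ⁿ⁻¹ / n · (∑ (rᵢ + sᵢ))⁻¹ · (∏ rᵢ! sᵢ!)⁻¹ · [X^r₁ Y^s₁ ⋯ X^rₙ Y^sₙ]`.
The terms of total degree `∑ (rᵢ + sᵢ)` above the nilpotency class `N` vanish and are left out. -/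
noncomputable def bchProduct (K : Type*) {𝔤 : Type*} [Field K] [LieRing 𝔤] [LieAlgebra K 𝔤]
    (X Y : 𝔤) : 𝔤 :=
  let N := LieModule.nilpotencyLength 𝔤 𝔤
  ∑ n ∈ Finset.Icc 1 N,
    ∑ e : Fin n → Fin (N + 1) × Fin (N + 1) with
        (∀ i, 0 < ((e i).1 : ℕ) + (e i).2) ∧ ∑ i, (((e i).1 : ℕ) + (e i).2) ≤ N,
      ((-1 : K) ^ (n - 1) / (n : K)
          * ((∑ i, (((e i).1 : ℕ) + (e i).2) : ℕ) : K)⁻¹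
          * ((∏ i, (((e i).1 : ℕ).factorial * ((e i).2 : ℕ).factorial) : ℕ) : K)⁻¹) •
        nestedBracket (List.ofFn fun i =>
          List.replicate (e i).1 X ++ List.replicate (e i).2 Y).flatten

/-- `exp : 𝔤 ≃ₜ G` is an exponential map identifying `G` with `(𝔤, ⋄)`, the nilpotent Lie group
with Lie algebra `𝔤`: the group law of `G` is given by the Baker–Campbell–Hausdorff formula. -/
def IsLieExp (K : Type*) {𝔤 G : Type*} [Field K] [LieRing 𝔤] [LieAlgebra K 𝔤]
    [TopologicalSpace 𝔤] [TopologicalSpace G] [Mul G] (exp : 𝔤 ≃ₜ G) : Prop :=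
  ∀ X Y : 𝔤, exp X * exp Y = exp (bchProduct K X Y)

section Dilations

variable {K 𝔤 ι : Type*} [Field K] [LieRing 𝔤] [LieAlgebra K 𝔤]

/-- The dilation `D_γ`, multiplication by `γ ^ k` on `V k`, written in a basis `b` with
`b i ∈ V (ν i)`. -/
noncomputable def dilation (b : Module.Basis ι K 𝔤) (ν : ι → ℕ) (γ : K) : 𝔤 →ₗ[K] 𝔤 :=
  b.constr K fun i => γ ^ ν i • b i

/-- The lattice `𝔤₀ = 𝒪 b₁ + ⋯ + 𝒪 b_d`. -/
def integralLattice [ValuativeRel K] (b : Module.Basis ι K 𝔤) : Set 𝔤 :=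
  {x | ∀ i, b.repr x i ∈ 𝒪[K]}

/-- The sets `G_n = exp (D_γ 𝔤₀)`, `γ = ϖ ^ n`, for a uniformizer `ϖ`. -/
def dilationFiltration {G : Type*} [ValuativeRel K] [TopologicalSpace 𝔤] [TopologicalSpace G]
    (exp : 𝔤 ≃ₜ G) (b : Module.Basis ι K 𝔤) (ν : ι → ℕ) (ϖ : 𝒪[K]) (n : ℤ) : Set G :=
  exp '' (dilation b ν ((ϖ : K) ^ n) '' integralLattice b)

end Dilations

section Operators

variable {G : Type*} [MeasurableSpace G]

open Classical in
/-- The homogeneous quasi-norm of a decreasing family `F` of sets: `|x| = |F n| ^ (1 / Q)` if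
`x ∈ F n \ F (n + 1)`, and `|x| = 0` if there is no such `n`, that is, if `x = e`. -/
noncomputable def quasiNorm (μ : Measure G) (F : ℤ → Set G) (Q : ℝ) (x : G) : ℝ :=
  if h : ∃ n : ℤ, x ∈ F n ∧ x ∉ F (n + 1) then μ.real (F h.choose) ^ (1 / Q) else 0

/-- The weighted measure `|x| ^ α dx`; its `L^r` space is `L^r_α`. -/
noncomputable def powerWeight (μ : Measure G) (N : G → ℝ) (α : ℝ) : Measure G :=
  μ.withDensity fun x => ENNReal.ofReal (N x ^ α)

/-- The fractional Hardy operator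
`H_δ f x = |x| ^ (-(Q - δ)) ∫_{|t| ≤ |x|} f t dt`. -/
noncomputable def hardy {𝕜 : Type*} [RCLike 𝕜] (μ : Measure G) (N : G → ℝ) (Q δ : ℝ)
    (f : G → 𝕜) (x : G) : 𝕜 :=
  (1 / N x ^ (Q - δ)) • ∫ t in {t | N t ≤ N x}, f t ∂μ

/-- The subspace of radial functions, `f x = φ |x|`, of `L^p(μ)`. -/
def radialLp (𝕜 : Type*) [RCLike 𝕜] (p : ℝ≥0∞) (μ : Measure G) (N : G → ℝ) :
    Submodule 𝕜 (Lp 𝕜 p μ) where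
  carrier := {f | ∃ φ : ℝ → 𝕜, f =ᵐ[μ] fun x => φ (N x)}
  zero_mem' := ⟨0, Lp.coeFn_zero 𝕜 p μ⟩
  add_mem' := by
    rintro f g ⟨φ, hφ⟩ ⟨ψ, hψ⟩
    exact ⟨fun s => φ s + ψ s, (Lp.coeFn_add f g).trans (hφ.add hψ)⟩
  smul_mem' := by
    rintro c f ⟨φ, hφ⟩
    exact ⟨fun s => c • φ s, (Lp.coeFn_smul c f).trans (hφ.const_smul c)⟩

end Operators

/-!
The theorem has a measure-theoretic half and an algebraic half, which meet in the notion of a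
geometric gauge (`IsGeometricGauge`): a measurable function `N` whose non-zero values are
`κ q ^ n`, `n : ℤ`, and whose ball of radius `ρ = κ q ^ n` has measure `ρ ^ Q`.

For a geometric gauge the integrals of powers of `N` over a ball and over the complement of a ball
are geometric series (`lintegral_ball`, `lintegral_coball`). Put `θ = Q / r' - α / r - δ > 0` and
`M = (1 - q ^ (-Q)) / (1 - q ^ (-θ))`. Schur's test with the weight `N ^ (θ - Q)`, that is, Hölder's
inequality on each ball followed by Tonelli's theorem, uses each of the two series once and bounds
the Hardy operator by `M` (`rpow_lintegral_ball_le`, `lintegral_hardy_le`). The weight is the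
function that formally attains the norm. The truncations of the nearby powers
`N ^ (ε + θ - Q)`, `ε > 0`, to a ball are radial and integrable to the required power, and on that
ball the operator multiplies them by `(1 - q ^ (-Q)) / (1 - q ^ (-(θ + ε))) * N ^ δ`; letting `ε`
tend to `0` gives the lower bound, already on radial functions (`le_norm_hardy_radial`).

It remains to see that the quasi-norm of `G` is a geometric gauge, which comes down to
`|G_n| = q ^ (-n Q) |G_0|`. In the coordinates given by a graded basis, the set `G_n` is a product
of fractional ideals `ϖ ^ (n ν i) 𝒪`, whose additive Haar measures are known from the index of the
maximal ideal, and `Q = ∑ ν i`. So it is enough that the Haar measure of `G` is the product measure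
in these coordinates. A nested bracket of length at least two changes by terms of degree greater
than `k` when one of its arguments changes by terms of degree at least `k`; hence
`X ⋄ (Y + Z) = X ⋄ Y + Z` modulo terms of degree higher than that of `Z`
(`LieGrading.bchProduct_add_sub_mem`). The coefficients of Dynkin's formula play no role here: the
factor in front of `Z` is found from `0 ⋄ Y = Y`. Left translations are thus triangular in the
coordinates, therefore compositions of shears, and preserve the product measure
(`measurePreserving_of_triangular`); uniqueness of Haar measure concludes.
-/

/-! ### Gauges with geometric values and integrals of their powers -/

/-- A gauge of homogeneous dimension `Q` on a measure space: a measurable function whose non-zero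
values are the numbers `κ q ^ n`, `n : ℤ`, and whose ball of radius `ρ = κ q ^ n` has measure
`ρ ^ Q`. -/
structure IsGeometricGauge {G : Type*} [MeasurableSpace G] (μ : Measure G) (N : G → ℝ)
    (Q q κ : ℝ) : Prop where
  dim_pos : 0 < Q
  one_lt : 1 < q
  scale_pos : 0 < κ
  measurable : Measurable N
  value : ∀ x, N x = 0 ∨ ∃ n : ℤ, N x = κ * q ^ n
  measure_ball : ∀ n : ℤ, μ {t | N t ≤ κ * q ^ n} = ENNReal.ofReal ((κ * q ^ n) ^ Q)

namespace IsGeometricGauge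

variable {G : Type*} [MeasurableSpace G] {μ : Measure G} {N : G → ℝ} {Q q κ : ℝ}

lemma radius_pos (h : IsGeometricGauge μ N Q q κ) (n : ℤ) : 0 < κ * q ^ n :=
  mul_pos h.scale_pos (zpow_pos (zero_lt_one.trans h.one_lt) n)

lemma nonneg (h : IsGeometricGauge μ N Q q κ) (x : G) : 0 ≤ N x := by
  rcases h.value x with hx | ⟨n, hx⟩
  · exact hx.ge
  · exact hx ▸ (h.radius_pos n).le

lemma exists_eq (h : IsGeometricGauge μ N Q q κ) {x : G} (hx : N x ≠ 0) :
    ∃ n : ℤ, N x = κ * q ^ n :=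
  (h.value x).resolve_left hx

lemma radius_strictMono (h : IsGeometricGauge μ N Q q κ) :
    StrictMono fun n : ℤ => κ * q ^ n := fun _ _ hab =>
  mul_lt_mul_of_pos_left (zpow_lt_zpow_right₀ h.one_lt hab) h.scale_pos

lemma radius_zpow_rpow (h : IsGeometricGauge μ N Q q κ) (n m : ℤ) (σ : ℝ) :
    (κ * q ^ (n + m)) ^ σ = (κ * q ^ n) ^ σ * q ^ (m * σ) := by
  have hq : 0 < q := zero_lt_one.trans h.one_lt
  rw [zpow_add₀ hq.ne', ← mul_assoc, Real.mul_rpow (h.radius_pos n).le (zpow_pos hq m).le,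
    ← Real.rpow_intCast q m, ← Real.rpow_mul hq.le]

lemma measure_zero (h : IsGeometricGauge μ N Q q κ) : μ {t | N t = 0} = 0 := by
  have hq : 0 < q := zero_lt_one.trans h.one_lt
  have hlt : q ^ (-Q) < 1 := Real.rpow_lt_one_of_one_lt_of_neg h.one_lt (by linarith [h.dim_pos])
  have hle : ∀ n : ℕ, μ {t | N t = 0} ≤ ENNReal.ofReal (κ ^ Q * (q ^ (-Q)) ^ n) := by
    intro n
    refine (measure_mono ?_).trans (h.measure_ball (0 + (-n : ℤ))).le |>.trans_eq ?_
    · intro t ht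
      exact (ht : N t = 0).le.trans (h.radius_pos _).le
    · rw [h.radius_zpow_rpow, zpow_zero, mul_one, ← Real.rpow_natCast (q ^ (-Q)) n,
        ← Real.rpow_mul hq.le]
      push_cast
      ring_nf
  have hlim : Filter.Tendsto (fun n : ℕ => ENNReal.ofReal (κ ^ Q * (q ^ (-Q)) ^ n)) Filter.atTop
      (nhds 0) := by
    have := (tendsto_pow_atTop_nhds_zero_of_lt_one (Real.rpow_pos_of_pos hq (-Q)).le hlt).const_mul
      (κ ^ Q)
    simpa using ENNReal.tendsto_ofReal this
  exact le_antisymm (ge_of_tendsto' hlim hle) zero_le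

lemma ae_pos (h : IsGeometricGauge μ N Q q κ) : ∀ᵐ x ∂μ, 0 < N x := by
  filter_upwards [measure_eq_zero_iff_ae_notMem.1 h.measure_zero] with x hx
  exact lt_of_le_of_ne (h.nonneg x) (Ne.symm hx)

lemma measurableSet_shell (h : IsGeometricGauge μ N Q q κ) (ρ : ℝ) :
    MeasurableSet {t | N t = ρ} :=
  measurableSet_eq_fun h.measurable measurable_const

lemma measurableSet_ball (h : IsGeometricGauge μ N Q q κ) (ρ : ℝ) :
    MeasurableSet {t | N t ≤ ρ} :=
  measurableSet_le h.measurable measurable_const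

lemma measurableSet_coball (h : IsGeometricGauge μ N Q q κ) (ρ : ℝ) :
    MeasurableSet {t | ρ ≤ N t} :=
  measurableSet_le measurable_const h.measurable

lemma measure_shell (h : IsGeometricGauge μ N Q q κ) (n : ℤ) :
    μ {t | N t = κ * q ^ n} = ENNReal.ofReal ((κ * q ^ n) ^ Q * (1 - q ^ (-Q))) := by
  have hset : {t | N t = κ * q ^ n} = {t | N t ≤ κ * q ^ n} \ {t | N t ≤ κ * q ^ (n + (-1))} := by
    ext t
    simp only [Set.mem_ofPred_eq, Set.mem_sdiff, not_le]
    constructor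
    · intro ht
      exact ⟨ht.le, by rw [ht]; exact h.radius_strictMono (by omega)⟩
    · rintro ⟨h1, h2⟩
      obtain ⟨m, hm⟩ := h.exists_eq ((h.radius_pos _).trans h2).ne'
      rw [hm] at h1 h2 ⊢
      have h3 := h.radius_strictMono.le_iff_le.1 h1
      have h4 := h.radius_strictMono.lt_iff_lt.1 h2
      rw [show m = n by omega]
  rw [hset, measure_sdiff _ (h.measurableSet_ball _).nullMeasurableSet, h.measure_ball,
    h.measure_ball, h.radius_zpow_rpow,
    ← ENNReal.ofReal_sub _ (by have := (h.radius_pos n).le; have := h.one_lt; positivity)]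
  · congr 1
    push_cast
    ring_nf
  · rw [h.measure_ball]; exact ENNReal.ofReal_ne_top
  · intro t ht
    exact le_trans (ht : N t ≤ _) (h.radius_strictMono (show n + (-1) < n by omega)).le

/-- Summation of `∫ |t| ^ (σ - Q) dt` over the shells of radius `κ q ^ (n + k j)`, `j : ℕ`: a
geometric series of ratio `q ^ (k σ)`. The ball and its complement are the cases `k = -1, 1`. -/
lemma lintegral_iUnion_shell (h : IsGeometricGauge μ N Q q κ) (n k : ℤ) (σ : ℝ)
    (hk : k * σ < 0) :
    ∫⁻ t in ⋃ j : ℕ, {t | N t = κ * q ^ (n + k * j)}, ENNReal.ofReal (N t ^ (σ - Q)) ∂μ =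
      ENNReal.ofReal ((1 - q ^ (-Q)) / (1 - q ^ (k * σ)) * (κ * q ^ n) ^ σ) := by
  have hq : 0 < q := zero_lt_one.trans h.one_lt
  have hk0 : k ≠ 0 := by rintro rfl; simp at hk
  have hlt : q ^ (k * σ) < 1 := Real.rpow_lt_one_of_one_lt_of_neg h.one_lt hk
  have hltQ : q ^ (-Q) < 1 := Real.rpow_lt_one_of_one_lt_of_neg h.one_lt (by linarith [h.dim_pos])
  rw [lintegral_iUnion (fun j => h.measurableSet_shell _)]
  · have hterm : ∀ j : ℕ, ∫⁻ t in {t | N t = κ * q ^ (n + k * j)},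
        ENNReal.ofReal (N t ^ (σ - Q)) ∂μ =
        ENNReal.ofReal ((1 - q ^ (-Q)) * (κ * q ^ n) ^ σ) * ENNReal.ofReal (q ^ (k * σ)) ^ j := by
      intro j
      rw [setLIntegral_congr_fun (h.measurableSet_shell _)
        (g := fun _ => ENNReal.ofReal ((κ * q ^ (n + k * j)) ^ (σ - Q)))
        (fun t ht => by simp only [Set.mem_ofPred_eq] at ht; simp only [ht]), setLIntegral_const,
        h.measure_shell, ← ENNReal.ofReal_mul (Real.rpow_nonneg (h.radius_pos _).le _),
        ← ENNReal.ofReal_pow (Real.rpow_nonneg hq.le _), ← ENNReal.ofReal_mul]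
      · congr 1
        rw [← mul_assoc, ← Real.rpow_add (h.radius_pos _), sub_add_cancel, h.radius_zpow_rpow,
          ← Real.rpow_natCast (q ^ (k * σ)) j, ← Real.rpow_mul hq.le]
        push_cast
        ring_nf
      · exact mul_nonneg (by linarith) (Real.rpow_nonneg (h.radius_pos _).le _)
    simp_rw [hterm]
    rw [ENNReal.tsum_mul_left, ENNReal.tsum_geometric, ← ENNReal.ofReal_one,
      ← ENNReal.ofReal_sub _ (Real.rpow_nonneg hq.le _),
      ← ENNReal.ofReal_inv_of_pos (by linarith), ← ENNReal.ofReal_mul]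
    · congr 1
      field_simp
    · exact mul_nonneg (by linarith) (Real.rpow_nonneg (h.radius_pos _).le _)
  · intro i j hij
    refine Set.disjoint_left.2 fun t hi hj => hij ?_
    have := h.radius_strictMono.injective ((hi : N t = _).symm.trans hj)
    have := mul_left_cancel₀ hk0 (add_left_cancel this)
    exact_mod_cast this

lemma lintegral_ball (h : IsGeometricGauge μ N Q q κ) {σ ρ : ℝ} (hσ : 0 < σ)
    (hρ : ∃ n : ℤ, ρ = κ * q ^ n) :
    ∫⁻ t in {t | N t ≤ ρ}, ENNReal.ofReal (N t ^ (σ - Q)) ∂μ =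
      ENNReal.ofReal ((1 - q ^ (-Q)) / (1 - q ^ (-σ)) * ρ ^ σ) := by
  obtain ⟨n, rfl⟩ := hρ
  have := h.lintegral_iUnion_shell n (-1) σ (by push_cast; linarith)
  push_cast at this
  rw [neg_one_mul] at this
  rw [← this]
  refine setLIntegral_congr ?_
  filter_upwards [h.ae_pos] with t ht
  obtain ⟨m, hm⟩ := h.exists_eq ht.ne'
  refine propext ?_
  change N t ≤ _ ↔ t ∈ ⋃ j : ℕ, {t | N t = κ * q ^ (n + -1 * (j : ℤ))}
  simp only [Set.mem_iUnion, Set.mem_ofPred_eq, hm]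
  rw [h.radius_strictMono.le_iff_le]
  constructor
  · intro hmn
    exact ⟨(n - m).toNat, by rw [show n + -1 * ((n - m).toNat : ℤ) = m by omega]⟩
  · rintro ⟨j, hj⟩
    have := h.radius_strictMono.injective hj
    omega

lemma lintegral_coball (h : IsGeometricGauge μ N Q q κ) {σ ρ : ℝ} (hσ : 0 < σ)
    (hρ : ∃ n : ℤ, ρ = κ * q ^ n) :
    ∫⁻ t in {t | ρ ≤ N t}, ENNReal.ofReal (N t ^ (-σ - Q)) ∂μ =
      ENNReal.ofReal ((1 - q ^ (-Q)) / (1 - q ^ (-σ)) * ρ ^ (-σ)) := by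
  obtain ⟨n, rfl⟩ := hρ
  have := h.lintegral_iUnion_shell n 1 (-σ) (by push_cast; linarith)
  push_cast at this
  rw [one_mul] at this
  rw [← this]
  congr 2
  ext t
  simp only [Set.mem_iUnion, Set.mem_ofPred_eq]
  constructor
  · intro ht
    obtain ⟨m, hm⟩ := h.exists_eq ((h.radius_pos n).trans_le ht).ne'
    rw [hm] at ht
    have hnm := h.radius_strictMono.le_iff_le.1 ht
    exact ⟨(m - n).toNat, by rw [hm, show n + 1 * ((m - n).toNat : ℤ) = m by omega]⟩
  · rintro ⟨j, hj⟩
    rw [hj, h.radius_strictMono.le_iff_le]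
    omega

end IsGeometricGauge

/-! ### The Schur test -/

namespace IsGeometricGauge

variable {G : Type*} [MeasurableSpace G] {μ : Measure G} {N : G → ℝ} {Q q κ : ℝ}

lemma one_sub_rpow_neg_pos (h : IsGeometricGauge μ N Q q κ) {θ : ℝ} (hθ : 0 < θ) :
    0 < 1 - q ^ (-θ) :=
  sub_pos.2 (Real.rpow_lt_one_of_one_lt_of_neg h.one_lt (by linarith))

lemma hardyConst_pos (h : IsGeometricGauge μ N Q q κ) {θ : ℝ} (hθ : 0 < θ) :
    0 < (1 - q ^ (-Q)) / (1 - q ^ (-θ)) :=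
  div_pos (h.one_sub_rpow_neg_pos h.dim_pos) (h.one_sub_rpow_neg_pos hθ)

/-- Hölder's inequality on a ball after multiplying and dividing `f` by the power
`N ^ ((Q - θ) / r')`, the Schur weight adapted to the extremal function `N ^ (θ - Q)`. -/
lemma rpow_lintegral_ball_le (h : IsGeometricGauge μ N Q q κ) {r θ ρ : ℝ} (hr : 1 < r)
    (hθ : 0 < θ) (hρ : ∃ n : ℤ, ρ = κ * q ^ n) {f : G → ℝ≥0∞} (hf : Measurable f) :
    (∫⁻ t in {t | N t ≤ ρ}, f t ∂μ) ^ r ≤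
      ENNReal.ofReal ((1 - q ^ (-Q)) / (1 - q ^ (-θ)) * ρ ^ θ) ^ (r - 1) *
        ∫⁻ t in {t | N t ≤ ρ}, f t ^ r * ENNReal.ofReal (N t ^ ((Q - θ) * (r - 1))) ∂μ := by
  have hr0 : 0 < r := by linarith
  have hr1 : 0 < r - 1 := by linarith
  obtain ⟨s, hs⟩ : ∃ s, s = r / (r - 1) := ⟨_, rfl⟩
  have hs0 : 0 < s := hs ▸ div_pos hr0 hr1
  have hconj : r.HolderConjugate s := by
    rw [Real.holderConjugate_iff]
    refine ⟨hr, ?_⟩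
    rw [hs]; field_simp; ring
  have hexp : 1 / s * r = r - 1 := by rw [hs]; field_simp
  have key := ENNReal.lintegral_mul_le_Lp_mul_Lq (μ.restrict {t | N t ≤ ρ}) hconj
    (f := fun t => f t * ENNReal.ofReal (N t ^ ((Q - θ) / s)))
    (g := fun t => ENNReal.ofReal (N t ^ (-(Q - θ) / s)))
    (hf.mul (h.measurable.pow_const _).ennreal_ofReal).aemeasurable
    (h.measurable.pow_const _).ennreal_ofReal.aemeasurable
  have hpos : ∀ᵐ t ∂μ.restrict {t | N t ≤ ρ}, 0 < N t := ae_restrict_of_ae h.ae_pos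
  have e1 : ∫⁻ t in {t | N t ≤ ρ}, ((fun t => f t * ENNReal.ofReal (N t ^ ((Q - θ) / s))) *
      fun t => ENNReal.ofReal (N t ^ (-(Q - θ) / s))) t ∂μ = ∫⁻ t in {t | N t ≤ ρ}, f t ∂μ := by
    refine lintegral_congr_ae ?_
    filter_upwards [hpos] with t ht
    simp only [Pi.mul_apply]
    rw [mul_assoc, ← ENNReal.ofReal_mul (Real.rpow_nonneg ht.le _), ← Real.rpow_add ht,
      show (Q - θ) / s + -(Q - θ) / s = 0 by ring]
    simp
  have e2 : ∫⁻ t in {t | N t ≤ ρ}, (f t * ENNReal.ofReal (N t ^ ((Q - θ) / s))) ^ r ∂μ =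
      ∫⁻ t in {t | N t ≤ ρ}, f t ^ r * ENNReal.ofReal (N t ^ ((Q - θ) * (r - 1))) ∂μ := by
    refine lintegral_congr_ae ?_
    filter_upwards [hpos] with t ht
    rw [ENNReal.mul_rpow_of_nonneg _ _ hr0.le,
      ENNReal.ofReal_rpow_of_nonneg (Real.rpow_nonneg ht.le _) hr0.le, ← Real.rpow_mul ht.le,
      show (Q - θ) / s * r = (Q - θ) * (r - 1) by rw [← hexp]; ring]
  have e3 : ∫⁻ t in {t | N t ≤ ρ}, ENNReal.ofReal (N t ^ (-(Q - θ) / s)) ^ s ∂μ =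
      ENNReal.ofReal ((1 - q ^ (-Q)) / (1 - q ^ (-θ)) * ρ ^ θ) := by
    rw [← h.lintegral_ball hθ hρ]
    refine lintegral_congr_ae ?_
    filter_upwards [hpos] with t ht
    rw [ENNReal.ofReal_rpow_of_nonneg (Real.rpow_nonneg ht.le _) hs0.le, ← Real.rpow_mul ht.le,
      div_mul_cancel₀ _ hs0.ne', neg_sub]
  rw [e1, e2, e3] at key
  calc (∫⁻ t in {t | N t ≤ ρ}, f t ∂μ) ^ r ≤ _ := ENNReal.rpow_le_rpow key hr0.le
    _ = _ := by
      rw [ENNReal.mul_rpow_of_nonneg _ _ hr0.le, ← ENNReal.rpow_mul, ← ENNReal.rpow_mul, hexp,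
        one_div_mul_cancel hr0.ne', ENNReal.rpow_one, mul_comm]

/-- The weighted Hardy inequality, by Tonelli's theorem from the two power integrals over a ball
and over the complement of a ball. -/
lemma lintegral_hardy_le [SFinite μ] (h : IsGeometricGauge μ N Q q κ) {r θ : ℝ} (hr : 1 < r)
    (hθ : 0 < θ) {f : G → ℝ≥0∞} (hf : Measurable f) :
    ∫⁻ x, (∫⁻ t in {t | N t ≤ N x}, f t ∂μ) ^ r * ENNReal.ofReal (N x ^ (-Q - θ * r)) ∂μ ≤
      ENNReal.ofReal ((1 - q ^ (-Q)) / (1 - q ^ (-θ))) ^ r *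
        ∫⁻ t, f t ^ r * ENNReal.ofReal (N t ^ ((Q - θ) * r - Q)) ∂μ := by
  have hr0 : 0 < r := by linarith
  have hr1 : 0 < r - 1 := by linarith
  obtain ⟨M, hM⟩ : ∃ M, M = (1 - q ^ (-Q)) / (1 - q ^ (-θ)) := ⟨_, rfl⟩
  have hM0 : 0 < M := hM ▸ h.hardyConst_pos hθ
  rw [← hM]
  obtain ⟨g, hg⟩ : ∃ g : G → ℝ≥0∞,
      g = fun t => f t ^ r * ENNReal.ofReal (N t ^ ((Q - θ) * (r - 1))) := ⟨_, rfl⟩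
  have hgm : Measurable g := by
    rw [hg]; exact (hf.pow_const r).mul (h.measurable.pow_const _).ennreal_ofReal
  have hle : MeasurableSet {p : G × G | N p.2 ≤ N p.1} :=
    measurableSet_le (h.measurable.comp measurable_snd) (h.measurable.comp measurable_fst)
  have hFm : Measurable (Function.uncurry fun x t =>
      {p : G × G | N p.2 ≤ N p.1}.indicator
        (fun p => ENNReal.ofReal (N p.1 ^ (-θ - Q)) * g p.2) (x, t)) := by
    refine Measurable.indicator ?_ hle
    exact ((h.measurable.comp measurable_fst).pow_const _).ennreal_ofReal.mul
      (hgm.comp measurable_snd)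
  calc ∫⁻ x, (∫⁻ t in {t | N t ≤ N x}, f t ∂μ) ^ r * ENNReal.ofReal (N x ^ (-Q - θ * r)) ∂μ
      ≤ ∫⁻ x, ENNReal.ofReal M ^ (r - 1) * ∫⁻ t, {p : G × G | N p.2 ≤ N p.1}.indicator
          (fun p => ENNReal.ofReal (N p.1 ^ (-θ - Q)) * g p.2) (x, t) ∂μ ∂μ := by
        refine lintegral_mono_ae ?_
        filter_upwards [h.ae_pos] with x hx
        have hin : ∫⁻ t, {p : G × G | N p.2 ≤ N p.1}.indicator
            (fun p => ENNReal.ofReal (N p.1 ^ (-θ - Q)) * g p.2) (x, t) ∂μ =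
            ENNReal.ofReal (N x ^ (-θ - Q)) * ∫⁻ t in {t | N t ≤ N x}, g t ∂μ := by
          rw [← lintegral_const_mul _ hgm, ← lintegral_indicator (h.measurableSet_ball _)]
          rfl
        rw [hin]
        have := h.rpow_lintegral_ball_le hr hθ (h.exists_eq hx.ne') hf
        rw [← hM] at this
        refine (mul_le_mul_left this _).trans_eq ?_
        rw [hg, ENNReal.ofReal_mul hM0.le, ENNReal.mul_rpow_of_nonneg _ _ hr1.le,
          ENNReal.ofReal_rpow_of_nonneg (Real.rpow_nonneg hx.le _) hr1.le, ← Real.rpow_mul hx.le]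
        have hw : N x ^ (-θ - Q) = N x ^ (θ * (r - 1)) * N x ^ (-Q - θ * r) := by
          rw [← Real.rpow_add hx]; ring_nf
        rw [hw, ENNReal.ofReal_mul (Real.rpow_nonneg hx.le _)]
        ring
    _ = ENNReal.ofReal M ^ (r - 1) * ∫⁻ t, ∫⁻ x, {p : G × G | N p.2 ≤ N p.1}.indicator
          (fun p => ENNReal.ofReal (N p.1 ^ (-θ - Q)) * g p.2) (x, t) ∂μ ∂μ := by
        rw [lintegral_const_mul' _ _ (ENNReal.rpow_ne_top_of_nonneg hr1.le ENNReal.ofReal_ne_top),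
          lintegral_lintegral_swap hFm.aemeasurable]
    _ = ENNReal.ofReal M ^ (r - 1) * ∫⁻ t, ENNReal.ofReal M *
          (f t ^ r * ENNReal.ofReal (N t ^ ((Q - θ) * r - Q))) ∂μ := by
        congr 1
        refine lintegral_congr_ae ?_
        filter_upwards [h.ae_pos] with t ht
        have hin : ∫⁻ x, {p : G × G | N p.2 ≤ N p.1}.indicator
            (fun p => ENNReal.ofReal (N p.1 ^ (-θ - Q)) * g p.2) (x, t) ∂μ =
            (∫⁻ x in {x | N t ≤ N x}, ENNReal.ofReal (N x ^ (-θ - Q)) ∂μ) * g t := by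
          rw [← lintegral_mul_const _ (h.measurable.pow_const _).ennreal_ofReal,
            ← lintegral_indicator (h.measurableSet_coball _)]
          rfl
        rw [hin, h.lintegral_coball hθ (h.exists_eq ht.ne'), ← hM, hg,
          ENNReal.ofReal_mul hM0.le]
        have hw : N t ^ ((Q - θ) * r - Q) = N t ^ (-θ) * N t ^ ((Q - θ) * (r - 1)) := by
          rw [← Real.rpow_add ht]; ring_nf
        rw [hw, ENNReal.ofReal_mul (Real.rpow_nonneg ht.le _)]
        ring
    _ = ENNReal.ofReal M ^ r * ∫⁻ t, f t ^ r * ENNReal.ofReal (N t ^ ((Q - θ) * r - Q)) ∂μ := by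
        rw [lintegral_const_mul' _ _ ENNReal.ofReal_ne_top, ← mul_assoc]
        congr 1
        rw [show r = (r - 1) + 1 by ring, ENNReal.rpow_add_of_nonneg _ _ (by linarith) (by norm_num)]
        simp

end IsGeometricGauge

/-! ### The Hardy operator and its norm -/

namespace IsGeometricGauge

variable {G : Type*} [MeasurableSpace G] {μ : Measure G} {N : G → ℝ} {Q q κ : ℝ}
variable {𝕜 : Type*} [RCLike 𝕜]

lemma absolutelyContinuous_powerWeight (h : IsGeometricGauge μ N Q q κ) (β : ℝ) :
    μ ≪ powerWeight μ N β := by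
  refine withDensity_absolutelyContinuous' (h.measurable.pow_const _).ennreal_ofReal.aemeasurable ?_
  filter_upwards [h.ae_pos] with x hx
  simpa using Real.rpow_pos_of_pos hx β

lemma lintegral_powerWeight (h : IsGeometricGauge μ N Q q κ) (β : ℝ) (g : G → ℝ≥0∞) :
    ∫⁻ x, g x ∂powerWeight μ N β = ∫⁻ x, g x * ENNReal.ofReal (N x ^ β) ∂μ := by
  rw [powerWeight, lintegral_withDensity_eq_lintegral_mul_non_measurable _
    (h.measurable.pow_const _).ennreal_ofReal (by simp)]
  simp only [Pi.mul_apply, mul_comm]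

lemma eLpNorm_powerWeight (h : IsGeometricGauge μ N Q q κ) (β : ℝ) {r : ℝ} (hr : 0 < r)
    (f : G → 𝕜) :
    eLpNorm f (ENNReal.ofReal r) (powerWeight μ N β) =
      (∫⁻ x, ‖f x‖ₑ ^ r * ENNReal.ofReal (N x ^ β) ∂μ) ^ (1 / r) := by
  rw [eLpNorm_eq_lintegral_rpow_enorm_toReal (by simpa using hr) ENNReal.ofReal_ne_top,
    ENNReal.toReal_ofReal hr.le, h.lintegral_powerWeight]

lemma stronglyMeasurable_hardy [SFinite μ] (h : IsGeometricGauge μ N Q q κ) (δ : ℝ) {f : G → 𝕜}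
    (hf : StronglyMeasurable f) : StronglyMeasurable (hardy μ N Q δ f) := by
  have hle : MeasurableSet {p : G × G | N p.2 ≤ N p.1} :=
    measurableSet_le (h.measurable.comp measurable_snd) (h.measurable.comp measurable_fst)
  have hF : StronglyMeasurable (Function.uncurry fun x t =>
      {p : G × G | N p.2 ≤ N p.1}.indicator (fun p => f p.2) (x, t)) :=
    (hf.comp_measurable measurable_snd).indicator hle
  have hw : StronglyMeasurable fun x => 1 / N x ^ (Q - δ) :=
    (measurable_const.div (h.measurable.pow_const _)).stronglyMeasurable
  convert hw.smul (hF.integral_prod_right (ν := μ)) using 1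
  funext x
  rw [hardy, ← integral_indicator (h.measurableSet_ball _)]
  rfl

lemma integrableOn_ball (h : IsGeometricGauge μ N Q q κ) {r θ : ℝ} (hr : 1 < r)
    (hθ : 0 < θ) (f : Lp 𝕜 (ENNReal.ofReal r) (powerWeight μ N ((Q - θ) * r - Q))) (x : G) :
    IntegrableOn f {t | N t ≤ N x} μ := by
  have hr0 : 0 < r := by linarith
  rcases h.value x with hx | hx
  · have h0 : μ {t | N t ≤ N x} = 0 := by
      refine measure_mono_null (fun t ht => ?_) h.measure_zero
      exact le_antisymm ((ht : N t ≤ N x).trans hx.le) (h.nonneg t)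
    rw [IntegrableOn, Measure.restrict_eq_zero.2 h0]
    exact integrable_zero_measure
  · have hfm := Lp.stronglyMeasurable f
    refine ⟨hfm.aestronglyMeasurable, ?_⟩
    have key := h.rpow_lintegral_ball_le hr hθ hx hfm.measurable.enorm
    have hfin : ∫⁻ t, ‖f t‖ₑ ^ r * ENNReal.ofReal (N t ^ ((Q - θ) * r - Q)) ∂μ ≠ ∞ := by
      have := Lp.eLpNorm_ne_top f
      rw [h.eLpNorm_powerWeight _ hr0] at this
      intro htop
      rw [htop] at this
      exact this (ENNReal.top_rpow_of_pos (by positivity))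
    have hρ : 0 < N x := by obtain ⟨n, hn⟩ := hx; exact hn ▸ h.radius_pos n
    -- On the ball `N ^ ((Q - θ) * (r - 1))` is at most a constant times `N ^ ((Q - θ) * r - Q)`,
    -- because `θ` is positive.
    have hcomp : ∫⁻ t in {t | N t ≤ N x}, ‖f t‖ₑ ^ r *
        ENNReal.ofReal (N t ^ ((Q - θ) * (r - 1))) ∂μ ≤ ENNReal.ofReal (N x ^ θ) *
        ∫⁻ t, ‖f t‖ₑ ^ r * ENNReal.ofReal (N t ^ ((Q - θ) * r - Q)) ∂μ := by
      rw [← lintegral_const_mul' _ _ ENNReal.ofReal_ne_top]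
      refine le_trans ?_ (setLIntegral_le_lintegral {t | N t ≤ N x} _)
      refine setLIntegral_mono_ae' (h.measurableSet_ball _) ?_
      filter_upwards [h.ae_pos] with t ht htx
      rw [mul_left_comm, ← ENNReal.ofReal_mul (Real.rpow_nonneg hρ.le _)]
      gcongr
      rw [show (Q - θ) * (r - 1) = θ + ((Q - θ) * r - Q) by ring, Real.rpow_add ht]
      exact mul_le_mul_of_nonneg_right (Real.rpow_le_rpow ht.le htx hθ.le)
        (Real.rpow_nonneg ht.le _)
    rw [hasFiniteIntegral_iff_enorm, lt_top_iff_ne_top]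
    intro htop
    rw [htop, ENNReal.top_rpow_of_pos hr0, top_le_iff] at key
    refine ENNReal.mul_ne_top (ENNReal.rpow_ne_top_of_nonneg (by linarith) ENNReal.ofReal_ne_top)
      (ne_top_of_le_ne_top (ENNReal.mul_ne_top ENNReal.ofReal_ne_top hfin) hcomp) key

lemma eLpNorm_hardy_le [SFinite μ] (h : IsGeometricGauge μ N Q q κ) {r θ α δ : ℝ} (hr : 1 < r)
    (hθ : 0 < θ) (hα : α + δ * r = (Q - θ) * r - Q) {f : G → 𝕜} (hf : StronglyMeasurable f) :
    eLpNorm (hardy μ N Q δ f) (ENNReal.ofReal r) (powerWeight μ N α) ≤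
      ENNReal.ofReal ((1 - q ^ (-Q)) / (1 - q ^ (-θ))) *
        eLpNorm f (ENNReal.ofReal r) (powerWeight μ N (α + δ * r)) := by
  have hr0 : 0 < r := by linarith
  rw [h.eLpNorm_powerWeight _ hr0, h.eLpNorm_powerWeight _ hr0, hα]
  have key := h.lintegral_hardy_le hr hθ hf.measurable.enorm
  have hpt : ∫⁻ x, ‖hardy μ N Q δ f x‖ₑ ^ r * ENNReal.ofReal (N x ^ α) ∂μ ≤
      ∫⁻ x, (∫⁻ t in {t | N t ≤ N x}, ‖f t‖ₑ ∂μ) ^ r *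
        ENNReal.ofReal (N x ^ (-Q - θ * r)) ∂μ := by
    refine lintegral_mono_ae ?_
    filter_upwards [h.ae_pos] with x hx
    have h1 : ‖hardy μ N Q δ f x‖ₑ ≤
        ENNReal.ofReal (N x ^ (-(Q - δ))) * ∫⁻ t in {t | N t ≤ N x}, ‖f t‖ₑ ∂μ := by
      rw [hardy, enorm_smul, one_div, ← Real.rpow_neg hx.le,
        Real.enorm_of_nonneg (Real.rpow_nonneg hx.le _)]
      gcongr
      exact enorm_integral_le_lintegral_enorm _
    calc ‖hardy μ N Q δ f x‖ₑ ^ r * ENNReal.ofReal (N x ^ α)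
        ≤ (ENNReal.ofReal (N x ^ (-(Q - δ))) * ∫⁻ t in {t | N t ≤ N x}, ‖f t‖ₑ ∂μ) ^ r *
          ENNReal.ofReal (N x ^ α) := by gcongr
      _ = _ := by
        rw [ENNReal.mul_rpow_of_nonneg _ _ hr0.le,
          ENNReal.ofReal_rpow_of_nonneg (Real.rpow_nonneg hx.le _) hr0.le, ← Real.rpow_mul hx.le,
          mul_right_comm, ← ENNReal.ofReal_mul (Real.rpow_nonneg hx.le _), ← Real.rpow_add hx,
          mul_comm]
        congr 3
        linear_combination hα
  calc _ ≤ (ENNReal.ofReal ((1 - q ^ (-Q)) / (1 - q ^ (-θ))) ^ r *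
        ∫⁻ t, ‖f t‖ₑ ^ r * ENNReal.ofReal (N t ^ ((Q - θ) * r - Q)) ∂μ) ^ (1 / r) :=
        ENNReal.rpow_le_rpow (hpt.trans key) (by positivity)
    _ = _ := by
      rw [ENNReal.mul_rpow_of_nonneg _ _ (by positivity), ← ENNReal.rpow_mul,
        mul_one_div_cancel hr0.ne', ENNReal.rpow_one]

/-- Existence of the Hardy operator as a bounded operator, with the upper bound for its norm. -/
lemma exists_hardy_clm [SFinite μ] (h : IsGeometricGauge μ N Q q κ) {r θ α δ : ℝ} (hr : 1 < r)
    [Fact (1 ≤ ENNReal.ofReal r)] (hθ : 0 < θ) (hα : α + δ * r = (Q - θ) * r - Q) :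
    ∃ H : Lp 𝕜 (ENNReal.ofReal r) (powerWeight μ N (α + δ * r)) →L[𝕜]
        Lp 𝕜 (ENNReal.ofReal r) (powerWeight μ N α),
      (∀ f, H f =ᵐ[μ] hardy μ N Q δ f) ∧ ‖H‖ ≤ (1 - q ^ (-Q)) / (1 - q ^ (-θ)) := by
  have hM := (h.hardyConst_pos hθ).le
  have hint : ∀ (f : Lp 𝕜 (ENNReal.ofReal r) (powerWeight μ N (α + δ * r))) (x : G),
      IntegrableOn f {t | N t ≤ N x} μ := by
    rw [hα]; exact h.integrableOn_ball hr hθ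
  have hmem : ∀ f : Lp 𝕜 (ENNReal.ofReal r) (powerWeight μ N (α + δ * r)),
      MemLp (hardy μ N Q δ f) (ENNReal.ofReal r) (powerWeight μ N α) := fun f =>
    ⟨(h.stronglyMeasurable_hardy δ (Lp.stronglyMeasurable f)).aestronglyMeasurable,
      (h.eLpNorm_hardy_le hr hθ hα (Lp.stronglyMeasurable f)).trans_lt
        (ENNReal.mul_lt_top ENNReal.ofReal_lt_top (Lp.eLpNorm_lt_top f))⟩
  have hae : ∀ {β : ℝ} {f g : G → 𝕜}, f =ᵐ[powerWeight μ N β] g → f =ᵐ[μ] g :=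
    fun {β} _ _ hfg => (h.absolutelyContinuous_powerWeight β).ae_eq hfg
  let L : Lp 𝕜 (ENNReal.ofReal r) (powerWeight μ N (α + δ * r)) →ₗ[𝕜]
      Lp 𝕜 (ENNReal.ofReal r) (powerWeight μ N α) :=
    { toFun := fun f => (hmem f).toLp _
      map_add' := fun f g => by
        rw [← MemLp.toLp_add]
        congr 1
        funext x
        simp only [hardy, Pi.add_apply]
        rw [← smul_add, ← integral_add (hint f x) (hint g x)]
        congr 1
        exact integral_congr_ae (ae_restrict_of_ae (hae (Lp.coeFn_add f g)))
      map_smul' := fun c f => by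
        rw [RingHom.id_apply, ← MemLp.toLp_const_smul]
        congr 1
        funext x
        simp only [hardy, Pi.smul_apply]
        rw [smul_comm c, ← integral_smul c]
        congr 1
        exact integral_congr_ae (ae_restrict_of_ae (hae (Lp.coeFn_smul c f))) }
  refine ⟨L.mkContinuous ((1 - q ^ (-Q)) / (1 - q ^ (-θ))) fun f => ?_, fun f => ?_,
    L.mkContinuous_norm_le hM _⟩
  · change ‖(hmem f).toLp _‖ ≤ _
    rw [Lp.norm_toLp, Lp.norm_def, ← ENNReal.toReal_ofReal hM, ← ENNReal.toReal_mul]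
    exact ENNReal.toReal_mono
      (ENNReal.mul_ne_top ENNReal.ofReal_ne_top (Lp.eLpNorm_ne_top f))
      (h.eLpNorm_hardy_le hr hθ hα (Lp.stronglyMeasurable f))
  · exact hae (hmem f).coeFn_toLp

/-- The truncated power `N ^ (ε + θ - Q)` on the ball of radius `κ` shows that the norm on radial
functions is at least `(1 - q ^ (-Q)) / (1 - q ^ (-(θ + ε)))`. -/
lemma le_norm_hardy_radial [SFinite μ] (h : IsGeometricGauge μ N Q q κ) {r θ α δ ε : ℝ}
    (hr : 1 < r) [Fact (1 ≤ ENNReal.ofReal r)] (hθ : 0 < θ) (hε : 0 < ε)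
    (hα : α + δ * r = (Q - θ) * r - Q)
    (H : Lp 𝕜 (ENNReal.ofReal r) (powerWeight μ N (α + δ * r)) →L[𝕜]
        Lp 𝕜 (ENNReal.ofReal r) (powerWeight μ N α))
    (hH : ∀ f, H f =ᵐ[μ] hardy μ N Q δ f) :
    (1 - q ^ (-Q)) / (1 - q ^ (-(θ + ε))) ≤
      ‖H.comp (radialLp 𝕜 (ENNReal.ofReal r) (powerWeight μ N (α + δ * r)) N).subtypeL‖ := by
  have hr0 : 0 < r := by linarith
  have hκ : ∃ n : ℤ, κ = κ * q ^ n := ⟨0, by simp⟩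
  obtain ⟨M, hM⟩ : ∃ M, M = (1 - q ^ (-Q)) / (1 - q ^ (-(θ + ε))) := ⟨_, rfl⟩
  have hM0 : 0 < M := hM ▸ h.hardyConst_pos (by linarith)
  obtain ⟨φ, hφ⟩ : ∃ φ : ℝ → 𝕜,
      φ = fun s => if s ≤ κ then ((s ^ (θ + ε - Q) : ℝ) : 𝕜) else 0 := ⟨_, rfl⟩
  have hφm : Measurable φ := by
    rw [hφ]
    exact Measurable.ite measurableSet_Iic
      (RCLike.measurable_ofReal.comp (measurable_id.pow_const _)) measurable_const
  have hφN : Measurable fun x => φ (N x) := hφm.comp h.measurable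
  have hnorm : ∫⁻ x, ‖φ (N x)‖ₑ ^ r * ENNReal.ofReal (N x ^ (α + δ * r)) ∂μ =
      ENNReal.ofReal ((1 - q ^ (-Q)) / (1 - q ^ (-(ε * r))) * κ ^ (ε * r)) := by
    rw [← h.lintegral_ball (by positivity) hκ, ← lintegral_indicator (h.measurableSet_ball _)]
    refine lintegral_congr_ae ?_
    filter_upwards [h.ae_pos] with x hx
    by_cases hxκ : N x ≤ κ
    · rw [Set.indicator_of_mem (by exact hxκ), hφ]
      simp only [if_pos hxκ]
      rw [← ofReal_norm, RCLike.norm_ofReal, abs_of_nonneg (Real.rpow_nonneg hx.le _),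
        ENNReal.ofReal_rpow_of_nonneg (Real.rpow_nonneg hx.le _) hr0.le, ← Real.rpow_mul hx.le,
        ← ENNReal.ofReal_mul (Real.rpow_nonneg hx.le _), ← Real.rpow_add hx, hα]
      ring_nf
    · rw [Set.indicator_of_notMem (by exact hxκ), hφ]
      simp [if_neg hxκ, hr0]
  have hnpos : 0 < (1 - q ^ (-Q)) / (1 - q ^ (-(ε * r))) * κ ^ (ε * r) :=
    mul_pos (h.hardyConst_pos (by positivity)) (Real.rpow_pos_of_pos h.scale_pos _)
  have hmem : MemLp (fun x => φ (N x)) (ENNReal.ofReal r) (powerWeight μ N (α + δ * r)) := by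
    refine ⟨hφN.aestronglyMeasurable, ?_⟩
    rw [h.eLpNorm_powerWeight _ hr0, hnorm]
    exact (ENNReal.rpow_ne_top_of_nonneg (by positivity) ENNReal.ofReal_ne_top).lt_top
  obtain ⟨f, hf⟩ : ∃ f, f = hmem.toLp _ := ⟨_, rfl⟩
  have hfrad : f ∈ radialLp 𝕜 (ENNReal.ofReal r) (powerWeight μ N (α + δ * r)) N :=
    ⟨φ, hf ▸ hmem.coeFn_toLp⟩
  have hfnorm : ‖f‖ = (((1 - q ^ (-Q)) / (1 - q ^ (-(ε * r))) * κ ^ (ε * r))) ^ (1 / r) := by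
    rw [hf, Lp.norm_toLp, h.eLpNorm_powerWeight _ hr0, hnorm,
      ENNReal.ofReal_rpow_of_nonneg hnpos.le (by positivity),
      ENNReal.toReal_ofReal (Real.rpow_nonneg hnpos.le _)]
  have hfpos : 0 < ‖f‖ := hfnorm ▸ Real.rpow_pos_of_pos hnpos _
  have hfae : f =ᵐ[μ] fun x => φ (N x) :=
    (h.absolutelyContinuous_powerWeight _).ae_eq (hf ▸ hmem.coeFn_toLp)
  -- On the ball of radius `κ` the operator multiplies the test function by `M * N ^ δ`.
  have hval : ∀ x, 0 < N x → N x ≤ κ →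
      hardy μ N Q δ f x = ((M * N x ^ (δ + (θ + ε - Q)) : ℝ) : 𝕜) := by
    intro x hx hxκ
    have hi : ∫ t in {t | N t ≤ N x}, f t ∂μ = ((M * N x ^ (θ + ε) : ℝ) : 𝕜) := by
      have h1 : ∫ t in {t | N t ≤ N x}, f t ∂μ =
          ∫ t in {t | N t ≤ N x}, ((N t ^ (θ + ε - Q) : ℝ) : 𝕜) ∂μ := by
        refine setIntegral_congr_ae (h.measurableSet_ball _) ?_
        filter_upwards [hfae] with t ht htx
        rw [ht, hφ]
        simp only [if_pos ((show N t ≤ N x from htx).trans hxκ)]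
      rw [h1, integral_ofReal, integral_eq_lintegral_of_nonneg_ae
        (Filter.Eventually.of_forall fun t => Real.rpow_nonneg (h.nonneg t) _)
        (h.measurable.pow_const _).aestronglyMeasurable,
        h.lintegral_ball (by linarith) (h.exists_eq hx.ne'), ← hM,
        ENNReal.toReal_ofReal (mul_nonneg hM0.le (Real.rpow_nonneg hx.le _))]
    rw [hardy, hi, RCLike.real_smul_eq_coe_mul, ← RCLike.ofReal_mul, one_div,
      ← Real.rpow_neg hx.le, mul_left_comm, ← Real.rpow_add hx]
    ring_nf
  have hle : ENNReal.ofReal M * eLpNorm f (ENNReal.ofReal r) (powerWeight μ N (α + δ * r)) ≤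
      eLpNorm (H f) (ENNReal.ofReal r) (powerWeight μ N α) := by
    rw [h.eLpNorm_powerWeight _ hr0, h.eLpNorm_powerWeight _ hr0]
    have : ENNReal.ofReal M = (ENNReal.ofReal M ^ r) ^ (1 / r) := by
      rw [← ENNReal.rpow_mul, mul_one_div_cancel hr0.ne', ENNReal.rpow_one]
    rw [this, ← ENNReal.mul_rpow_of_nonneg _ _ (by positivity),
      ← lintegral_const_mul' _ _ (ENNReal.rpow_ne_top_of_nonneg hr0.le ENNReal.ofReal_ne_top)]
    refine ENNReal.rpow_le_rpow (lintegral_mono_ae ?_) (by positivity)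
    filter_upwards [h.ae_pos, hfae, hH f] with x hx hfx hHx
    by_cases hxκ : N x ≤ κ
    · rw [hHx, hval x hx hxκ, hfx, hφ]
      simp only [if_pos hxκ]
      rw [← ofReal_norm, ← ofReal_norm, RCLike.norm_ofReal, RCLike.norm_ofReal,
        abs_of_nonneg (Real.rpow_nonneg hx.le _),
        abs_of_nonneg (mul_nonneg hM0.le (Real.rpow_nonneg hx.le _)), ENNReal.ofReal_mul hM0.le,
        ENNReal.mul_rpow_of_nonneg _ _ hr0.le, mul_assoc,
        ENNReal.ofReal_rpow_of_nonneg (Real.rpow_nonneg hx.le _) hr0.le,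
        ENNReal.ofReal_rpow_of_nonneg (Real.rpow_nonneg hx.le _) hr0.le,
        ← ENNReal.ofReal_mul (Real.rpow_nonneg (Real.rpow_nonneg hx.le _) _),
        ← ENNReal.ofReal_mul (Real.rpow_nonneg (Real.rpow_nonneg hx.le _) _),
        ← Real.rpow_mul hx.le, ← Real.rpow_mul hx.le, ← Real.rpow_add hx, ← Real.rpow_add hx]
      apply le_of_eq
      ring_nf
    · rw [hfx, hφ]
      simp [if_neg hxκ, hr0]
  have hreal : M * ‖f‖ ≤ ‖H f‖ := by
    rw [Lp.norm_def, Lp.norm_def, ← ENNReal.toReal_ofReal hM0.le, ← ENNReal.toReal_mul]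
    exact ENNReal.toReal_mono (Lp.eLpNorm_ne_top _) hle
  rw [← hM]
  refine le_of_mul_le_mul_right (hreal.trans ?_) hfpos
  exact (H.comp (radialLp 𝕜 (ENNReal.ofReal r) (powerWeight μ N (α + δ * r)) N).subtypeL).le_opNorm
    ⟨f, hfrad⟩

theorem exists_hardy_clm_norm_eq [SFinite μ] (h : IsGeometricGauge μ N Q q κ) {r θ α δ : ℝ}
    (hr : 1 < r) [Fact (1 ≤ ENNReal.ofReal r)] (hθ : 0 < θ)
    (hα : α + δ * r = (Q - θ) * r - Q) :
    ∃ H : Lp 𝕜 (ENNReal.ofReal r) (powerWeight μ N (α + δ * r)) →L[𝕜]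
        Lp 𝕜 (ENNReal.ofReal r) (powerWeight μ N α),
      (∀ f, H f =ᵐ[μ] hardy μ N Q δ f) ∧
      ‖H‖ = ‖H.comp (radialLp 𝕜 (ENNReal.ofReal r) (powerWeight μ N (α + δ * r)) N).subtypeL‖ ∧
      ‖H‖ = (1 - q ^ (-Q)) / (1 - q ^ (-θ)) := by
  obtain ⟨H, hH, hHle⟩ := h.exists_hardy_clm (𝕜 := 𝕜) hr hθ hα
  have hq : 0 < q := zero_lt_one.trans h.one_lt
  obtain ⟨R, hR⟩ : ∃ R, R =
      radialLp 𝕜 (ENNReal.ofReal r) (powerWeight μ N (α + δ * r)) N := ⟨_, rfl⟩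
  have h1 : ‖H.comp R.subtypeL‖ ≤ ‖H‖ :=
    (H.opNorm_comp_le _).trans
      (mul_le_of_le_one_right (norm_nonneg _) (Submodule.norm_subtypeL_le _))
  have h2 : (1 - q ^ (-Q)) / (1 - q ^ (-θ)) ≤ ‖H.comp R.subtypeL‖ := by
    have hcont : Filter.Tendsto (fun ε : ℝ => (1 - q ^ (-Q)) / (1 - q ^ (-(θ + ε))))
        (nhdsWithin 0 (Set.Ioi 0)) (nhds ((1 - q ^ (-Q)) / (1 - q ^ (-(θ + 0))))) := by
      have hc : ContinuousAt (fun ε : ℝ => (1 - q ^ (-Q)) / (1 - q ^ (-(θ + ε)))) 0 := by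
        refine ContinuousAt.div continuousAt_const (continuousAt_const.sub ?_) ?_
        · exact ContinuousAt.rpow continuousAt_const (by fun_prop) (Or.inl hq.ne')
        · simpa using (h.one_sub_rpow_neg_pos hθ).ne'
      exact hc.tendsto.mono_left nhdsWithin_le_nhds
    rw [add_zero] at hcont
    refine le_of_tendsto hcont ?_
    filter_upwards [self_mem_nhdsWithin] with ε hε
    exact hR ▸ h.le_norm_hardy_radial hr hθ hε hα H hH
  rw [← hR]
  exact ⟨H, hH, le_antisymm (hHle.trans h2) h1, le_antisymm hHle (h2.trans h1)⟩

end IsGeometricGauge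

/-! ### The quasi-norm of a filtration -/

section Filtration

variable {G : Type*} [MeasurableSpace G] {μ : Measure G} {F : ℤ → Set G} {Q q κ : ℝ}

lemma quasiNorm_eq_of_mem_diff (hQ : 0 < Q) (hq : 1 < q) (hκ : 0 < κ) (hF : Antitone F)
    (hμ : ∀ n, μ (F n) = ENNReal.ofReal ((κ * q ^ (-n)) ^ Q)) {n : ℤ} {x : G}
    (hx : x ∈ F n) (hx' : x ∉ F (n + 1)) : quasiNorm μ F Q x = κ * q ^ (-n) := by
  have h : ∃ n : ℤ, x ∈ F n ∧ x ∉ F (n + 1) := ⟨n, hx, hx'⟩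
  have hn : h.choose = n := by
    have h1 := h.choose_spec
    by_contra hne
    rcases lt_or_gt_of_ne hne with hlt | hlt
    · exact h1.2 (hF (by omega : h.choose + 1 ≤ n) hx)
    · exact hx' (hF (by omega : n + 1 ≤ h.choose) h1.1)
  have hpos : 0 < κ * q ^ (-n) := mul_pos hκ (zpow_pos (by linarith) _)
  rw [quasiNorm, dif_pos h, hn, Measure.real, hμ,
    ENNReal.toReal_ofReal (Real.rpow_nonneg hpos.le _), ← Real.rpow_mul hpos.le,
    mul_one_div_cancel hQ.ne', Real.rpow_one]

lemma quasiNorm_eq_zero {x : G} (hx : ∀ n, x ∈ F n) : quasiNorm μ F Q x = 0 := by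
  rw [quasiNorm, dif_neg]
  rintro ⟨n, -, hn⟩
  exact hn (hx _)

omit [MeasurableSpace G] in
lemma forall_mem_or_exists_mem_diff (hF : Antitone F) (hcov : ∀ x, ∃ n, x ∈ F n) (x : G) :
    (∀ n, x ∈ F n) ∨ ∃ n, x ∈ F n ∧ x ∉ F (n + 1) := by
  by_contra! hcon
  obtain ⟨⟨m, hm⟩, hstep⟩ := hcon
  obtain ⟨n, hn⟩ := hcov x
  have hup : ∀ k : ℕ, x ∈ F (n + k) := by
    intro k
    induction k with
    | zero => simpa using hn
    | succ k ih => simpa [add_assoc] using hstep _ ih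
  exact hm (hF (by omega : m ≤ n + ((m - n).toNat : ℤ)) (hup _))

lemma quasiNorm_le_iff (hQ : 0 < Q) (hq : 1 < q) (hκ : 0 < κ) (hF : Antitone F)
    (hcov : ∀ x, ∃ n, x ∈ F n) (hμ : ∀ n, μ (F n) = ENNReal.ofReal ((κ * q ^ (-n)) ^ Q))
    (n : ℤ) (x : G) : quasiNorm μ F Q x ≤ κ * q ^ (-n) ↔ x ∈ F n := by
  have hpos : 0 < κ * q ^ (-n) := mul_pos hκ (zpow_pos (by linarith) _)
  rcases forall_mem_or_exists_mem_diff hF hcov x with hx | ⟨m, hm, hm'⟩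
  · rw [quasiNorm_eq_zero hx]
    exact ⟨fun _ => hx n, fun _ => hpos.le⟩
  · rw [quasiNorm_eq_of_mem_diff hQ hq hκ hF hμ hm hm', mul_le_mul_iff_right₀ hκ,
      zpow_le_zpow_iff_right₀ hq, neg_le_neg_iff]
    refine ⟨fun h => hF h hm, fun h => ?_⟩
    by_contra! hlt
    exact hm' (hF (by omega) h)

theorem isGeometricGauge_quasiNorm (hQ : 0 < Q) (hq : 1 < q) (hκ : 0 < κ)
    (hFm : ∀ n, MeasurableSet (F n)) (hF : Antitone F)
    (hcov : ∀ x, ∃ n, x ∈ F n) (hμ : ∀ n, μ (F n) = ENNReal.ofReal ((κ * q ^ (-n)) ^ Q)) :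
    IsGeometricGauge μ (quasiNorm μ F Q) Q q κ := by
  have hval : ∀ x, quasiNorm μ F Q x = 0 ∨ ∃ n : ℤ, quasiNorm μ F Q x = κ * q ^ n := by
    intro x
    rcases forall_mem_or_exists_mem_diff hF hcov x with hx | ⟨m, hm, hm'⟩
    · exact Or.inl (quasiNorm_eq_zero hx)
    · exact Or.inr ⟨-m, quasiNorm_eq_of_mem_diff hQ hq hκ hF hμ hm hm'⟩
  have hball : ∀ n : ℤ, {x | quasiNorm μ F Q x ≤ κ * q ^ n} = F (-n) := by
    intro n
    ext x
    rw [← quasiNorm_le_iff hQ hq hκ hF hcov hμ (-n) x, neg_neg]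
    rfl
  refine ⟨hQ, hq, hκ, measurable_of_Iic fun c => ?_, hval, fun n => by rw [hball, hμ, neg_neg]⟩
  have hset : quasiNorm μ F Q ⁻¹' Set.Iic c =
      ⋃ (_ : 0 ≤ c), (⋂ n, F n) ∪ ⋃ (n : ℤ) (_ : κ * q ^ n ≤ c), F (-n) := by
    ext x
    simp only [Set.mem_preimage, Set.mem_Iic, Set.mem_iUnion, Set.mem_union, Set.mem_iInter,
      exists_prop]
    constructor
    · intro hx
      rcases forall_mem_or_exists_mem_diff hF hcov x with h | ⟨m, hm, hm'⟩
      · exact ⟨(quasiNorm_eq_zero h).symm.le.trans hx, Or.inl h⟩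
      · rw [quasiNorm_eq_of_mem_diff hQ hq hκ hF hμ hm hm'] at hx
        have hpos : 0 < κ * q ^ (-m) := mul_pos hκ (zpow_pos (by linarith) _)
        exact ⟨hpos.le.trans hx, Or.inr ⟨-m, hx, by rwa [neg_neg]⟩⟩
    · rintro ⟨hc, h | ⟨n, hn, hx⟩⟩
      · exact (quasiNorm_eq_zero h).le.trans hc
      · rw [← hball] at hx
        exact le_trans hx hn
  rw [hset]
  exact MeasurableSet.iUnion fun _ => (MeasurableSet.iInter hFm).union
    (MeasurableSet.iUnion fun n => MeasurableSet.iUnion fun _ => hFm _)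

end Filtration

/-! ### Graded bases and the triangularity of the Baker–Campbell–Hausdorff product -/

section Graded

variable {K 𝔤 ι : Type*} [Field K] [LieRing 𝔤] [LieAlgebra K 𝔤]

lemma LieGrading.repr_eq_zero (𝒱 : LieGrading K 𝔤) (b : Module.Basis ι K 𝔤) {ν : ι → ℕ}
    (hb : ∀ i, b i ∈ 𝒱.V (ν i)) {m : ℕ} {x : 𝔤} (hx : x ∈ 𝒱.V m) {i : ι} (hi : ν i ≠ m) :
    b.repr x i = 0 := by
  classical
  let _ : DirectSum.Decomposition 𝒱.V := 𝒱.isInternal.chooseDecomposition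
  let π : 𝔤 →ₗ[K] 𝔤 := (𝒱.V m).subtype ∘ₗ DirectSum.component K ℕ (fun k => 𝒱.V k) m ∘ₗ
    (DirectSum.decomposeLinearEquiv 𝒱.V).toLinearMap
  have hπ : ∀ y, π y = (DirectSum.decompose 𝒱.V y m : 𝔤) := fun y => rfl
  -- The projection to `V m` kills the coordinates of all other degrees.
  have hcomp : (Finsupp.lapply i : (ι →₀ K) →ₗ[K] K) ∘ₗ b.repr.toLinearMap ∘ₗ π = 0 := by
    refine b.ext fun j => ?_
    by_cases hj : ν j = m
    · have hij : i ≠ j := by rintro rfl; exact hi hj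
      have : π (b j) = b j := by rw [hπ, DirectSum.decompose_of_mem_same _ (hj ▸ hb j)]
      simp [this, hij.symm]
    · have : π (b j) = 0 := by rw [hπ, DirectSum.decompose_of_mem_ne _ (hb j) hj]
      simp [this]
  have := LinearMap.congr_fun hcomp x
  have hx' : π x = x := by rw [hπ, DirectSum.decompose_of_mem_same _ hx]
  simpa [hx'] using this

lemma LieGrading.degree_mem (𝒱 : LieGrading K 𝔤) (b : Module.Basis ι K 𝔤) {ν : ι → ℕ}
    (hb : ∀ i, b i ∈ 𝒱.V (ν i)) (i : ι) : ν i ∈ Finset.Icc 1 𝒱.step := by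
  by_contra h
  have := hb i
  rw [𝒱.eq_bot _ h, Submodule.mem_bot] at this
  exact b.ne_zero i this

lemma LieGrading.finrank_eq [Fintype ι] (𝒱 : LieGrading K 𝔤) (b : Module.Basis ι K 𝔤) {ν : ι → ℕ}
    (hb : ∀ i, b i ∈ 𝒱.V (ν i)) (m : ℕ) :
    Module.finrank K (𝒱.V m) = (Finset.univ.filter fun i => ν i = m).card := by
  have hspan : 𝒱.V m = Submodule.span K (Set.range fun i : {i // ν i = m} => b i) := by
    apply le_antisymm
    · intro x hx
      rw [← b.sum_repr x]
      refine Submodule.sum_mem _ fun i _ => ?_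
      by_cases hi : ν i = m
      · exact Submodule.smul_mem _ _ (Submodule.subset_span ⟨⟨i, hi⟩, rfl⟩)
      · rw [𝒱.repr_eq_zero b hb hx hi, zero_smul]
        exact Submodule.zero_mem _
    · rw [Submodule.span_le]
      rintro _ ⟨⟨i, rfl⟩, rfl⟩
      exact hb i
  have hli : LinearIndependent K fun i : {i // ν i = m} => b i :=
    b.linearIndependent.comp _ Subtype.val_injective
  rw [hspan, finrank_span_eq_card hli, Fintype.card_subtype]

lemma LieGrading.homogeneousDim_eq [Fintype ι] (𝒱 : LieGrading K 𝔤) (b : Module.Basis ι K 𝔤)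
    {ν : ι → ℕ} (hb : ∀ i, b i ∈ 𝒱.V (ν i)) : 𝒱.homogeneousDim = ∑ i, ν i := by
  rw [LieGrading.homogeneousDim,
    ← Finset.sum_fiberwise_of_maps_to (t := Finset.Icc 1 𝒱.step) (g := ν)
      fun i _ => 𝒱.degree_mem b hb i]
  refine Finset.sum_congr rfl fun k _ => ?_
  rw [𝒱.finrank_eq b hb, Finset.sum_congr rfl (fun i hi => (Finset.mem_filter.1 hi).2),
    Finset.sum_const, smul_eq_mul, mul_comm]

/-- The descending filtration attached to a basis whose `i`-th vector has degree `ν i`: the span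
of the basis vectors of degree at least `k`. -/
def degreeFiltration (b : Module.Basis ι K 𝔤) (ν : ι → ℕ) (k : ℕ) : Submodule K 𝔤 where
  carrier := {x | ∀ i, ν i < k → b.repr x i = 0}
  zero_mem' := by simp
  add_mem' := fun hx hy i hi => by simp [hx i hi, hy i hi]
  smul_mem' := fun c x hx i hi => by simp [hx i hi]

lemma degreeFiltration_succ_le (b : Module.Basis ι K 𝔤) (ν : ι → ℕ) (k : ℕ) :
    degreeFiltration b ν (k + 1) ≤ degreeFiltration b ν k :=
  fun _ hx i hi => hx i (hi.trans k.lt_succ_self)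

lemma LieGrading.lie_mem_degreeFiltration [Fintype ι] (𝒱 : LieGrading K 𝔤)
    (b : Module.Basis ι K 𝔤) {ν : ι → ℕ} (hb : ∀ i, b i ∈ 𝒱.V (ν i)) {k : ℕ} (x : 𝔤) {y : 𝔤}
    (hy : y ∈ degreeFiltration b ν k) : ⁅x, y⁆ ∈ degreeFiltration b ν (k + 1) := by
  rw [← b.sum_repr x, ← b.sum_repr y, sum_lie]
  refine Submodule.sum_mem _ fun i _ => ?_
  rw [lie_sum]
  refine Submodule.sum_mem _ fun j _ => ?_
  rw [smul_lie, lie_smul]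
  refine Submodule.smul_mem _ _ ?_
  by_cases hj : ν j < k
  · rw [hy j hj, zero_smul]
    exact Submodule.zero_mem _
  · refine Submodule.smul_mem _ _ fun l hl => ?_
    have hi := (Finset.mem_Icc.1 (𝒱.degree_mem b hb i)).1
    exact 𝒱.repr_eq_zero b hb (𝒱.lie_mem _ _ _ (hb i) _ (hb j)) (by omega)

lemma LieGrading.lie_mem_degreeFiltration' [Fintype ι] (𝒱 : LieGrading K 𝔤)
    (b : Module.Basis ι K 𝔤) {ν : ι → ℕ} (hb : ∀ i, b i ∈ 𝒱.V (ν i)) {k : ℕ} {x : 𝔤} (y : 𝔤)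
    (hx : x ∈ degreeFiltration b ν k) : ⁅x, y⁆ ∈ degreeFiltration b ν (k + 1) := by
  rw [← lie_skew]
  exact Submodule.neg_mem _ (𝒱.lie_mem_degreeFiltration b hb y hx)

lemma LieGrading.lie_sub_lie_mem [Fintype ι] (𝒱 : LieGrading K 𝔤)
    (b : Module.Basis ι K 𝔤) {ν : ι → ℕ} (hb : ∀ i, b i ∈ 𝒱.V (ν i)) {k : ℕ} {x x' y y' : 𝔤}
    (hx : x' - x ∈ degreeFiltration b ν k) (hy : y' - y ∈ degreeFiltration b ν k) :
    ⁅x', y'⁆ - ⁅x, y⁆ ∈ degreeFiltration b ν (k + 1) := by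
  have : ⁅x', y'⁆ - ⁅x, y⁆ = ⁅x' - x, y'⁆ + ⁅x, y' - y⁆ := by
    rw [sub_lie, lie_sub]; abel
  rw [this]
  exact Submodule.add_mem _ (𝒱.lie_mem_degreeFiltration' b hb _ hx)
    (𝒱.lie_mem_degreeFiltration b hb _ hy)

/-- The value of the word `w` in two letters at `X` (for `true`) and `Y` (for `false`). -/
def wordBracket (w : List Bool) (X Y : 𝔤) : 𝔤 :=
  nestedBracket (w.map fun c => bif c then X else Y)

lemma LieGrading.wordBracket_sub_mem [Fintype ι] (𝒱 : LieGrading K 𝔤)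
    (b : Module.Basis ι K 𝔤) {ν : ι → ℕ} (hb : ∀ i, b i ∈ 𝒱.V (ν i)) {k : ℕ} (X Y : 𝔤) {Z : 𝔤}
    (hZ : Z ∈ degreeFiltration b ν k) (w : List Bool) :
    wordBracket w X (Y + Z) - wordBracket w X Y ∈ degreeFiltration b ν k := by
  have hletter : ∀ c : Bool, (bif c then X else Y + Z) - (bif c then X else Y) ∈
      degreeFiltration b ν k := by
    rintro (_ | _)
    · simpa using hZ
    · simp
  induction w with
  | nil => simp [wordBracket, nestedBracket]
  | cons c w ih =>
    cases w with
    | nil => exact hletter c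
    | cons c' w =>
      exact degreeFiltration_succ_le b ν k (𝒱.lie_sub_lie_mem b hb (hletter c) ih)

/-- To leading order a word changes by a fixed multiple of `Z` when `Z` is added to its second
letter; the multiple is zero for words of length at least two. -/
lemma LieGrading.exists_wordBracket_linear [Fintype ι] (𝒱 : LieGrading K 𝔤)
    (b : Module.Basis ι K 𝔤) {ν : ι → ℕ} (hb : ∀ i, b i ∈ 𝒱.V (ν i)) (w : List Bool) :
    ∃ c : K, ∀ (k : ℕ) (X Y Z : 𝔤), Z ∈ degreeFiltration b ν k →
      wordBracket w X (Y + Z) - wordBracket w X Y - c • Z ∈ degreeFiltration b ν (k + 1) := by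
  match w with
  | [] => exact ⟨0, fun k X Y Z _ => by simp [wordBracket, nestedBracket]⟩
  | [true] => exact ⟨0, fun k X Y Z _ => by simp [wordBracket, nestedBracket]⟩
  | [false] => exact ⟨1, fun k X Y Z _ => by simp [wordBracket, nestedBracket]⟩
  | c :: c' :: w =>
    refine ⟨0, fun k X Y Z hZ => ?_⟩
    rw [zero_smul, sub_zero]
    refine 𝒱.lie_sub_lie_mem b hb ?_ (𝒱.wordBracket_sub_mem b hb X Y hZ (c' :: w))
    cases c
    · simpa using hZ
    · simp

lemma exists_word_eq {n N : ℕ} (e : Fin n → Fin (N + 1) × Fin (N + 1)) :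
    ∃ w : List Bool, ∀ X Y : 𝔤, nestedBracket (List.ofFn fun i =>
      List.replicate (e i).1 X ++ List.replicate (e i).2 Y).flatten = wordBracket w X Y := by
  refine ⟨(List.ofFn fun i =>
    List.replicate (e i).1 true ++ List.replicate (e i).2 false).flatten, fun X Y => ?_⟩
  rw [wordBracket, List.map_flatten, List.map_ofFn]
  congr 3
  funext i
  simp

/-- The Baker–Campbell–Hausdorff product as a linear combination of brackets of words. -/
lemma exists_bchProduct_eq_sum (K 𝔤 : Type*) [Field K] [LieRing 𝔤] [LieAlgebra K 𝔤] :
    ∃ (σ : ℕ → Type) (s : Finset ℕ) (t : ∀ n, Finset (σ n)) (a : ∀ n, σ n → K)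
      (w : ∀ n, σ n → List Bool), ∀ X Y : 𝔤,
        bchProduct K X Y = ∑ n ∈ s, ∑ e ∈ t n, a n e • wordBracket (w n e) X Y := by
  obtain ⟨N, hN⟩ : ∃ N, N = LieModule.nilpotencyLength 𝔤 𝔤 := ⟨_, rfl⟩
  choose w hw using fun n (e : Fin n → Fin (N + 1) × Fin (N + 1)) => exists_word_eq (𝔤 := 𝔤) e
  refine ⟨fun n => Fin n → Fin (N + 1) × Fin (N + 1), Finset.Icc 1 N,
    fun n => Finset.univ.filter fun e =>
      (∀ i, 0 < ((e i).1 : ℕ) + (e i).2) ∧ ∑ i, (((e i).1 : ℕ) + (e i).2) ≤ N,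
    fun n e => (-1 : K) ^ (n - 1) / (n : K)
          * ((∑ i, (((e i).1 : ℕ) + (e i).2) : ℕ) : K)⁻¹
          * ((∏ i, (((e i).1 : ℕ).factorial * ((e i).2 : ℕ).factorial) : ℕ) : K)⁻¹,
    w, fun X Y => ?_⟩
  simp_rw [← hw]
  subst hN
  rfl

/-- The linear part of the Baker–Campbell–Hausdorff product in its second argument is a multiple
of the identity. -/
lemma LieGrading.exists_bchProduct_linear [Fintype ι] (𝒱 : LieGrading K 𝔤)
    (b : Module.Basis ι K 𝔤) {ν : ι → ℕ} (hb : ∀ i, b i ∈ 𝒱.V (ν i)) :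
    ∃ c : K, ∀ (k : ℕ) (X Y Z : 𝔤), Z ∈ degreeFiltration b ν k →
      bchProduct K X (Y + Z) - bchProduct K X Y - c • Z ∈ degreeFiltration b ν (k + 1) := by
  obtain ⟨σ, s, t, a, w, hsum⟩ := exists_bchProduct_eq_sum K 𝔤
  choose c hc using fun n e => 𝒱.exists_wordBracket_linear b hb (w n e)
  refine ⟨∑ n ∈ s, ∑ e ∈ t n, a n e * c n e, fun k X Y Z hZ => ?_⟩
  have : bchProduct K X (Y + Z) - bchProduct K X Y - (∑ n ∈ s, ∑ e ∈ t n, a n e * c n e) • Z =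
      ∑ n ∈ s, ∑ e ∈ t n, a n e • (wordBracket (w n e) X (Y + Z) - wordBracket (w n e) X Y -
        c n e • Z) := by
    simp only [hsum, Finset.sum_smul, Finset.sum_sub_distrib, smul_sub, mul_smul]
  rw [this]
  exact Submodule.sum_mem _ fun n _ => Submodule.sum_mem _ fun e _ =>
    Submodule.smul_mem _ _ (hc n e k X Y Z hZ)

lemma wordBracket_zero (w : List Bool) : wordBracket w (0 : 𝔤) 0 = 0 := by
  match w with
  | [] => rfl
  | [c] => cases c <;> rfl
  | c :: c' :: w =>
    change ⁅(bif c then (0 : 𝔤) else 0), _⁆ = 0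
    cases c <;> exact zero_lie _

lemma bchProduct_zero_zero : bchProduct K (0 : 𝔤) 0 = 0 := by
  obtain ⟨σ, s, t, a, w, hsum⟩ := exists_bchProduct_eq_sum K 𝔤
  simp [hsum, wordBracket_zero]

lemma IsLieExp.map_zero [TopologicalSpace 𝔤] {G : Type*} [TopologicalSpace G] [Group G]
    {exp : 𝔤 ≃ₜ G} (hexp : IsLieExp K exp) : exp 0 = 1 := by
  have h := hexp 0 0
  rw [bchProduct_zero_zero] at h
  exact mul_eq_left.1 h

/-- The group law is `X ⋄ (Y + Z) = X ⋄ Y + Z` modulo terms of higher degree than `Z`. The factor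
in front of `Z` is read off from `0 ⋄ Y = Y`. -/
lemma LieGrading.bchProduct_add_sub_mem [Fintype ι] (𝒱 : LieGrading K 𝔤)
    (b : Module.Basis ι K 𝔤) {ν : ι → ℕ} (hb : ∀ i, b i ∈ 𝒱.V (ν i))
    [TopologicalSpace 𝔤] {G : Type*} [TopologicalSpace G] [Group G]
    {exp : 𝔤 ≃ₜ G} (hexp : IsLieExp K exp) {k : ℕ} (X Y : 𝔤) {Z : 𝔤}
    (hZ : Z ∈ degreeFiltration b ν k) :
    bchProduct K X (Y + Z) - bchProduct K X Y - Z ∈ degreeFiltration b ν (k + 1) := by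
  obtain ⟨c, hc⟩ := 𝒱.exists_bchProduct_linear b hb
  have hzero : ∀ W : 𝔤, bchProduct K 0 W = W := fun W => by
    have h := hexp 0 W
    rw [hexp.map_zero, one_mul] at h
    exact (exp.injective h).symm
  have h1 := hc k 0 0 Z hZ
  rw [hzero, hzero, zero_add, sub_zero] at h1
  have h2 := Submodule.sub_mem _ (hc k X Y Z hZ) h1
  convert h2 using 1
  abel

end Graded

/-! ### Triangular maps preserve product measures -/

section Triangular

variable {ι A : Type*} [Fintype ι] [AddCommGroup A] [MeasurableSpace A] [MeasurableAdd₂ A]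
  (lam : Measure A) [SigmaFinite lam] [lam.IsAddLeftInvariant]

/-- A shear, which translates the coordinates outside `p` by a function of the coordinates in
`p`, preserves a product of invariant measures. -/
lemma measurePreserving_shear (p : ι → Prop) [DecidablePred p] {g : (ι → A) → ι → A}
    (hgm : Measurable g)
    (hg : ∀ y y' : ι → A, (∀ j, p j → y j = y' j) → ∀ i, ¬ p i → g y i = g y' i) :
    MeasurePreserving (fun (y : ι → A) i => if p i then y i else y i + g y i)
      (Measure.pi fun _ => lam) (Measure.pi fun _ => lam) := by
  let e := MeasurableEquiv.piEquivPiSubtypeProd (fun _ : ι => A) p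
  have he : MeasurePreserving e (Measure.pi fun _ => lam)
      ((Measure.pi fun _ => lam).prod (Measure.pi fun _ => lam)) :=
    measurePreserving_piEquivPiSubtypeProd (fun _ => lam) p
  let t : ({i // p i} → A) → {i // ¬ p i} → A := fun a i => g (e.symm (a, 0)) i
  have htm : Measurable t := by
    refine measurable_pi_lambda _ fun i => ?_
    exact (measurable_pi_apply _).comp
      (hgm.comp (e.symm.measurable.comp (measurable_id.prodMk measurable_const)))
  have hskew : MeasurePreserving
      (fun z : ({i // p i} → A) × ({i // ¬ p i} → A) => (id z.1, t z.1 + z.2))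
      ((Measure.pi fun _ => lam).prod (Measure.pi fun _ => lam))
      ((Measure.pi fun _ => lam).prod (Measure.pi fun _ => lam)) := by
    refine MeasurePreserving.skew_product (g := fun a c => t a + c) (.id _) ?_ ?_
    · exact (htm.comp measurable_fst).add measurable_snd
    · exact Filter.Eventually.of_forall fun a => map_add_left_eq_self _ _
  have hcomp := (he.symm e).comp (hskew.comp he)
  convert hcomp using 1
  funext y i
  have hy : ∀ i (hi : ¬ p i), t (e y).1 ⟨i, hi⟩ = g y i := fun i hi =>
    hg _ _ (fun j hj => by
      simp [e, MeasurableEquiv.piEquivPiSubtypeProd, Equiv.piEquivPiSubtypeProd, hj]) i hi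
  by_cases hi : p i
  · simp [e, MeasurableEquiv.piEquivPiSubtypeProd, Equiv.piEquivPiSubtypeProd, hi]
  · have hr : (e.symm ((e y).1, t (e y).1 + (e y).2)) i = t (e y).1 ⟨i, hi⟩ + y i := by
      simp [e, MeasurableEquiv.piEquivPiSubtypeProd, Equiv.piEquivPiSubtypeProd, hi]
    rw [if_neg hi, add_comm]
    exact (hr.trans (by rw [hy i hi])).symm

/-- A map is triangular for the degrees `ν` if it changes each coordinate by a function of the
coordinates of lower degree. It is then a composition of shears, one for each degree. -/
lemma measurePreserving_of_triangular (ν : ι → ℕ) [MeasurableNeg A] {T : (ι → A) → ι → A}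
    (hTm : Measurable T)
    (hT : ∀ (y y' : ι → A) i, (∀ j, ν j < ν i → y j = y' j) → T y i - y i = T y' i - y' i) :
    MeasurePreserving T (Measure.pi fun _ => lam) (Measure.pi fun _ => lam) := by
  have hgm : Measurable fun (y : ι → A) i => T y i - y i := by
    refine measurable_pi_lambda _ fun i => ?_
    simp only [sub_eq_add_neg]
    exact ((measurable_pi_apply i).comp hTm).add (measurable_pi_apply i).neg
  -- Applying `T` in the degrees above `k` first and the shear in degree `k` afterwards is correct
  -- because the shear only looks at coordinates of degree below `k`, which are still unchanged.
  have hstep : ∀ k, MeasurePreserving (fun (y : ι → A) i => if ν i < k + 1 then y i else T y i)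
      (Measure.pi fun _ => lam) (Measure.pi fun _ => lam) →
      MeasurePreserving (fun (y : ι → A) i => if ν i < k then y i else T y i)
      (Measure.pi fun _ => lam) (Measure.pi fun _ => lam) := by
    intro k hk
    have hS := measurePreserving_shear lam (fun i => ν i ≠ k) hgm (fun y y' hyy i hi =>
      hT y y' i fun j hj => hyy j (by have := not_not.1 hi; omega))
    convert hS.comp hk using 1
    funext y i
    simp only [Function.comp_apply]
    rcases lt_trichotomy (ν i) k with h | h | h
    · simp [h, h.ne, h.trans k.lt_succ_self]
    · subst h
      have := hT (fun j => if ν j < ν i + 1 then y j else T y j) y i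
        (fun j hj => by simp [hj.trans (ν i).lt_succ_self])
      simp only [Nat.lt_succ_self, if_true, sub_left_inj] at this
      simp only [lt_irrefl, if_false, ne_eq, not_true_eq_false, add_sub_cancel]
      exact this.symm
    · simp [h.not_gt, h.ne', show ¬ ν i < k + 1 by omega]
  obtain ⟨n, hn⟩ : ∃ n, ∀ i, ν i < n :=
    ⟨Finset.univ.sup ν + 1, fun i => Nat.lt_succ_of_le (Finset.le_sup (Finset.mem_univ i))⟩
  have hall : ∀ k, MeasurePreserving (fun (y : ι → A) i => if ν i < n - k then y i else T y i)
      (Measure.pi fun _ => lam) (Measure.pi fun _ => lam) := by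
    intro k
    induction k with
    | zero =>
      convert MeasurePreserving.id (Measure.pi fun _ : ι => lam) using 1
      funext y i
      simp [hn]
    | succ k ih =>
      by_cases hk : k < n
      · refine hstep _ ?_
        rwa [show n - (k + 1) + 1 = n - k by omega]
      · rwa [show n - (k + 1) = n - k by omega]
  simpa using hall n

end Triangular

/-! ### Haar measure of a local field -/

section LocalField

variable {K : Type*} [Field K] [ValuativeRel K] [TopologicalSpace K]
  [IsNonarchimedeanLocalField K]

variable (K) in
lemma IsNonarchimedeanLocalField.secondCountableTopology : SecondCountableTopology K := by
  let := IsTopologicalAddGroup.rightUniformSpace K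
  have := isUniformAddGroup_of_addCommGroup (G := K)
  let : (Valued.v (R := K)).RankOne :=
  { hom' := IsRankLeOne.nonempty.some.emb (R := K).comp MonoidWithZeroHom.ValueGroup₀.embedding
    strictMono' := IsRankLeOne.nonempty.some.strictMono.comp
        MonoidWithZeroHom.ValueGroup₀.embedding_strictMono }
  open scoped Valued in
  have : ProperSpace K := .of_nontriviallyNormedField_of_weaklyLocallyCompactSpace K
  infer_instance

/-- The fractional ideal `ϖ ^ m 𝒪`. -/
def uniformizerBall (ϖ : 𝒪[K]) (m : ℤ) : Set K := {a | (ϖ : K) ^ (-m) * a ∈ 𝒪[K]}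

omit [TopologicalSpace K] [IsNonarchimedeanLocalField K] in
lemma Irreducible.coe_integer_ne_zero {ϖ : 𝒪[K]} (hϖ : Irreducible ϖ) : (ϖ : K) ≠ 0 := by
  simpa using hϖ.ne_zero

lemma isClopen_uniformizerBall (ϖ : 𝒪[K]) (m : ℤ) : IsClopen (uniformizerBall ϖ m) := by
  have hc : Continuous fun a : K => (ϖ : K) ^ (-m) * a := continuous_const.mul continuous_id
  have hop : IsOpen (𝒪[K].toAddSubgroup : Set K) := by
    refine AddSubgroup.isOpen_of_mem_nhds _ (g := 0) ?_
    refine (IsValuativeTopology.hasBasis_nhds_zero' K).mem_iff.2 ⟨1, one_ne_zero, fun x hx => ?_⟩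
    exact (show valuation K x < 1 from hx).le
  exact ⟨(AddSubgroup.isClosed_of_isOpen _ hop).preimage hc, hop.preimage hc⟩

lemma measurableSet_integer [MeasurableSpace K] [BorelSpace K] :
    MeasurableSet (𝒪[K] : Set K) := by
  simpa [uniformizerBall] using (isClopen_uniformizerBall (1 : 𝒪[K]) 0).isOpen.measurableSet

lemma isCompact_uniformizerBall {ϖ : 𝒪[K]} (hϖ : Irreducible ϖ) (m : ℤ) :
    IsCompact (uniformizerBall ϖ m) := by
  have h0 := hϖ.coe_integer_ne_zero
  have hcpt : IsCompact (𝒪[K] : Set K) :=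
    isCompact_iff_compactSpace.2 (inferInstance : CompactSpace 𝒪[K])
  convert hcpt.image (f := fun a => (ϖ : K) ^ m * a) (continuous_const.mul continuous_id) using 1
  ext a
  constructor
  · intro ha
    exact ⟨_, ha, by simp [mul_inv_cancel_left₀ (zpow_ne_zero m h0)]⟩
  · rintro ⟨c, hc, rfl⟩
    simpa [uniformizerBall, inv_mul_cancel_left₀ (zpow_ne_zero m h0)] using hc

omit [TopologicalSpace K] [IsNonarchimedeanLocalField K] in
lemma uniformizerBall_anti (ϖ : 𝒪[K]) (hϖ : Irreducible ϖ) : Antitone (uniformizerBall ϖ) := by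
  intro m n hmn a ha
  have h0 := hϖ.coe_integer_ne_zero
  obtain ⟨k, rfl⟩ := Int.le.dest hmn
  have : (ϖ : K) ^ (-m) * a = (ϖ : K) ^ k * ((ϖ : K) ^ (-(m + (k : ℤ))) * a) := by
    rw [← mul_assoc, ← zpow_natCast, ← zpow_add₀ h0]
    ring_nf
  change (ϖ : K) ^ (-m) * a ∈ 𝒪[K]
  rw [this]
  exact mul_mem (pow_mem ϖ.2 k) ha

lemma exists_mem_uniformizerBall {ϖ : 𝒪[K]} (hϖ : Irreducible ϖ) (a : K) :
    ∃ m : ℕ, a ∈ uniformizerBall ϖ (-m) := by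
  have h0 := hϖ.coe_integer_ne_zero
  rcases eq_or_ne a 0 with rfl | ha
  · exact ⟨0, by simp [uniformizerBall]⟩
  by_cases hint : a ∈ 𝒪[K]
  · exact ⟨0, by simpa [uniformizerBall] using hint⟩
  · have hinv : a⁻¹ ∈ 𝒪[K] := by
      rw [Valuation.mem_integer_iff] at hint ⊢
      rw [map_inv₀]
      exact inv_le_one_of_one_le₀ (not_le.1 hint).le
    have hne : (⟨a⁻¹, hinv⟩ : 𝒪[K]) ≠ 0 := by
      intro h
      exact inv_ne_zero ha (congrArg Subtype.val h)
    obtain ⟨m, hm⟩ := IsDiscreteValuationRing.associated_pow_irreducible hne hϖ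
    obtain ⟨u, hu⟩ := hm
    refine ⟨m, ?_⟩
    have hu' : a⁻¹ * ((u : 𝒪[K]) : K) = (ϖ : K) ^ m := congrArg Subtype.val hu
    change (ϖ : K) ^ (-(-(m : ℤ))) * a ∈ 𝒪[K]
    rw [neg_neg, zpow_natCast, ← hu', mul_right_comm, inv_mul_cancel₀ ha, one_mul]
    exact (u : 𝒪[K]).2

lemma one_lt_natCard_residueField : 1 < Nat.card 𝓀[K] := Finite.one_lt_card

variable [MeasurableSpace K] [BorelSpace K] (lam : Measure K) [lam.IsAddHaarMeasure]

/-- Passing from `ϖ ^ m 𝒪` to `ϖ ^ (m + 1) 𝒪` divides the measure by the number of cosets of the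
maximal ideal in `𝒪`. -/
lemma card_mul_measure_uniformizerBall_succ {ϖ : 𝒪[K]} (hϖ : Irreducible ϖ) (m : ℤ) :
    Nat.card 𝓀[K] * lam (uniformizerBall ϖ (m + 1)) = lam (uniformizerBall ϖ m) := by
  have h0 := hϖ.coe_integer_ne_zero
  let f : 𝒪[K] → K := fun c => (ϖ : K) ^ m * c
  have hf : MeasurableEmbedding f := by
    have hemb : MeasurableEmbedding ((↑) : 𝒪[K] → K) :=
      MeasurableEmbedding.subtype_coe measurableSet_integer
    exact (Homeomorph.mulLeft₀ ((ϖ : K) ^ m) (zpow_ne_zero m h0)).measurableEmbedding.comp hemb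
  have himage : ∀ S : Set 𝒪[K], (lam.comap f) S = lam (f '' S) := fun S =>
    hf.comap_apply lam S
  have hinv : (lam.comap f).IsAddLeftInvariant := by
    refine ⟨fun c => ?_⟩
    ext S hS
    rw [Measure.map_apply (measurable_const_add c) hS, himage, himage,
      ← measure_preimage_add lam (-f c) (f '' ((fun x => c + x) ⁻¹' S))]
    congr 1
    ext a
    simp only [Set.mem_preimage, Set.mem_image]
    constructor
    · rintro ⟨x, hx, hxa⟩
      refine ⟨c + x, hx, ?_⟩
      simp only [f] at hxa ⊢
      push_cast
      rw [mul_add, hxa]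
      ring
    · rintro ⟨x, hx, rfl⟩
      refine ⟨-c + x, by simpa using hx, ?_⟩
      simp only [f]
      push_cast
      ring
  have huniv : f '' Set.univ = uniformizerBall ϖ m := by
    ext a
    constructor
    · rintro ⟨c, -, rfl⟩
      simp [f, uniformizerBall, inv_mul_cancel_left₀ (zpow_ne_zero m h0)]
    · intro ha
      exact ⟨⟨_, ha⟩, trivial, by simp [f, mul_inv_cancel_left₀ (zpow_ne_zero m h0)]⟩
  have hmax : f '' (𝓂[K] : Set 𝒪[K]) = uniformizerBall ϖ (m + 1) := by
    rw [hϖ.maximalIdeal_eq]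
    ext a
    constructor
    · rintro ⟨c, hc, rfl⟩
      obtain ⟨x, rfl⟩ := Ideal.mem_span_singleton'.1 hc
      have : (ϖ : K) ^ (-(m + 1)) * ((ϖ : K) ^ m * ((x : K) * ϖ)) = x := by
        rw [neg_add, zpow_add₀ h0, zpow_neg, zpow_neg_one]
        field_simp
      change (ϖ : K) ^ (-(m + 1)) * ((ϖ : K) ^ m * ((x : K) * ϖ)) ∈ 𝒪[K]
      rw [this]
      exact x.2
    · intro ha
      refine ⟨⟨_, ha⟩ * ϖ, Ideal.mem_span_singleton'.2 ⟨_, rfl⟩, ?_⟩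
      change (ϖ : K) ^ m * ((ϖ : K) ^ (-(m + 1)) * a * ϖ) = a
      rw [neg_add, zpow_add₀ h0, zpow_neg, zpow_neg_one]
      field_simp
  have hcard : (Submodule.toAddSubgroup 𝓂[K]).index = Nat.card 𝓀[K] := rfl
  have hfin : (Submodule.toAddSubgroup 𝓂[K]).FiniteIndex :=
    ⟨by rw [hcard]; exact (zero_lt_one.trans one_lt_natCard_residueField).ne'⟩
  have hmeas : MeasurableSet ((Submodule.toAddSubgroup 𝓂[K] : AddSubgroup 𝒪[K]) : Set 𝒪[K]) := by
    rw [← hf.measurableSet_image]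
    change MeasurableSet (f '' (𝓂[K] : Set 𝒪[K]))
    rw [hmax]
    exact (isClopen_uniformizerBall ϖ _).isOpen.measurableSet
  have := AddSubgroup.index_mul_measure _ hmeas (lam.comap f)
  rw [hcard, himage, himage, huniv] at this
  rw [← this, ← hmax]
  rfl

lemma measure_uniformizerBall {ϖ : 𝒪[K]} (hϖ : Irreducible ϖ) (m : ℤ) :
    lam (uniformizerBall ϖ m) =
      ENNReal.ofReal ((Nat.card 𝓀[K] : ℝ) ^ (-m)) * lam (uniformizerBall ϖ 0) := by
  have hq : (0 : ℝ) < Nat.card 𝓀[K] := by exact_mod_cast Finite.card_pos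
  have hstep : ∀ m, lam (uniformizerBall ϖ m) =
      ENNReal.ofReal (Nat.card 𝓀[K] : ℝ) * lam (uniformizerBall ϖ (m + 1)) := fun m => by
    rw [ENNReal.ofReal_natCast, card_mul_measure_uniformizerBall_succ lam hϖ m]
  induction m using Int.induction_on with
  | zero => simp
  | succ k ih =>
    rw [hstep] at ih
    have h1 : ENNReal.ofReal ((Nat.card 𝓀[K] : ℝ)) ≠ 0 := (ENNReal.ofReal_pos.2 hq).ne'
    refine (ENNReal.mul_right_inj h1 ENNReal.ofReal_ne_top).1 ?_
    rw [ih, ← mul_assoc, ← ENNReal.ofReal_mul hq.le]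
    congr 2
    rw [neg_add, zpow_add₀ hq.ne', zpow_neg_one]
    field_simp
  | pred k ih =>
    rw [hstep, sub_add_cancel, ih, ← mul_assoc, ← ENNReal.ofReal_mul hq.le]
    congr 2
    rw [neg_sub, sub_neg_eq_add, zpow_add₀ hq.ne', neg_neg, zpow_one]

end LocalField

/-! ### Haar measure of the graded group -/

section GradedGroup

variable {K : Type*} [Field K] [ValuativeRel K] [TopologicalSpace K]
  [IsNonarchimedeanLocalField K] {𝔤 : Type*} [LieRing 𝔤] [LieAlgebra K 𝔤]
  [TopologicalSpace 𝔤] [IsModuleTopology K 𝔤]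
  {G : Type*} [TopologicalSpace G] {ι : Type*} [Fintype ι]

/-- Coordinates of the first kind on `G` in the basis `b`. -/
noncomputable def coordHomeomorph (exp : 𝔤 ≃ₜ G) (b : Module.Basis ι K 𝔤) : (ι → K) ≃ₜ G :=
  have : ContinuousAdd 𝔤 := IsModuleTopology.toContinuousAdd K 𝔤
  Homeomorph.trans
    { toEquiv := b.equivFun.symm.toEquiv
      continuous_toFun := IsModuleTopology.continuous_of_linearMap b.equivFun.symm.toLinearMap
      continuous_invFun := IsModuleTopology.continuous_of_linearMap b.equivFun.toLinearMap } exp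

lemma coordHomeomorph_apply (exp : 𝔤 ≃ₜ G) (b : Module.Basis ι K 𝔤) (y : ι → K) :
    coordHomeomorph exp b y = exp (b.equivFun.symm y) := rfl

lemma coordHomeomorph_symm_apply (exp : 𝔤 ≃ₜ G) (b : Module.Basis ι K 𝔤) (x : G) :
    (coordHomeomorph exp b).symm x = b.equivFun (exp.symm x) := rfl

omit [ValuativeRel K] [TopologicalSpace K] [IsNonarchimedeanLocalField K] [TopologicalSpace 𝔤]
  [IsModuleTopology K 𝔤] in
lemma equivFun_dilation (b : Module.Basis ι K 𝔤) (ν : ι → ℕ) (γ : K) (z : 𝔤) (i : ι) :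
    b.equivFun (dilation b ν γ z) i = γ ^ ν i * b.equivFun z i := by
  classical
  have : dilation b ν γ z = b.equivFun.symm fun i => γ ^ ν i * b.equivFun z i := by
    rw [dilation, Module.Basis.constr_apply_fintype, b.equivFun_symm_apply]
    exact Finset.sum_congr rfl fun i _ => by rw [smul_smul, mul_comm]
  rw [this, LinearEquiv.apply_symm_apply]

lemma dilationFiltration_eq (exp : 𝔤 ≃ₜ G) (b : Module.Basis ι K 𝔤) (ν : ι → ℕ) {ϖ : 𝒪[K]}
    (hϖ : Irreducible ϖ) (n : ℤ) :
    dilationFiltration exp b ν ϖ n = (coordHomeomorph exp b).symm ⁻¹'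
      Set.univ.pi fun i => uniformizerBall ϖ (n * ν i) := by
  have h0 := hϖ.coe_integer_ne_zero
  have hpow : ∀ i, ((ϖ : K) ^ n) ^ ν i = (ϖ : K) ^ (n * (ν i : ℤ)) := fun i => by
    rw [zpow_mul, zpow_natCast]
  ext x
  simp only [dilationFiltration, Set.mem_preimage, Set.mem_univ_pi, coordHomeomorph_symm_apply]
  constructor
  · rintro ⟨_, ⟨z, hz, rfl⟩, rfl⟩ i
    rw [Homeomorph.symm_apply_apply, equivFun_dilation, hpow, uniformizerBall, Set.mem_ofPred_eq,
      zpow_neg, inv_mul_cancel_left₀ (zpow_ne_zero _ h0)]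
    exact hz i
  · intro hx
    refine ⟨exp.symm x, ⟨b.equivFun.symm fun i =>
      (ϖ : K) ^ (-(n * (ν i : ℤ))) * b.equivFun (exp.symm x) i, fun i => ?_, ?_⟩, by simp⟩
    · rw [← b.equivFun_apply, LinearEquiv.apply_symm_apply]
      exact hx i
    · refine b.equivFun.injective (funext fun i => ?_)
      rw [equivFun_dilation, LinearEquiv.apply_symm_apply, hpow, zpow_neg,
        mul_inv_cancel_left₀ (zpow_ne_zero _ h0)]

lemma antitone_dilationFiltration (exp : 𝔤 ≃ₜ G) (b : Module.Basis ι K 𝔤) (ν : ι → ℕ) {ϖ : 𝒪[K]}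
    (hϖ : Irreducible ϖ) : Antitone (dilationFiltration exp b ν ϖ) := by
  intro m n hmn
  rw [dilationFiltration_eq exp b ν hϖ, dilationFiltration_eq exp b ν hϖ]
  exact Set.preimage_mono (Set.pi_mono fun i _ =>
    uniformizerBall_anti ϖ hϖ (mul_le_mul_of_nonneg_right hmn (Int.natCast_nonneg _)))

lemma exists_mem_dilationFiltration (exp : 𝔤 ≃ₜ G) (b : Module.Basis ι K 𝔤) {ν : ι → ℕ}
    (hν : ∀ i, 1 ≤ ν i) {ϖ : 𝒪[K]} (hϖ : Irreducible ϖ) (x : G) :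
    ∃ n, x ∈ dilationFiltration exp b ν ϖ n := by
  choose m hm using fun i => exists_mem_uniformizerBall hϖ (b.equivFun (exp.symm x) i)
  refine ⟨-(Finset.univ.sup m : ℕ), ?_⟩
  rw [dilationFiltration_eq exp b ν hϖ]
  refine Set.mem_univ_pi.2 fun i => uniformizerBall_anti ϖ hϖ ?_ (hm i)
  have h1 : m i ≤ Finset.univ.sup m := Finset.le_sup (Finset.mem_univ i)
  have h2 : m i ≤ Finset.univ.sup m * ν i := h1.trans (Nat.le_mul_of_pos_right _ (hν i))
  rw [neg_mul, neg_le_neg_iff]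
  exact_mod_cast h2

lemma measurableSet_dilationFiltration [MeasurableSpace G] [BorelSpace G] (exp : 𝔤 ≃ₜ G)
    (b : Module.Basis ι K 𝔤) (ν : ι → ℕ) {ϖ : 𝒪[K]} (hϖ : Irreducible ϖ) (n : ℤ) :
    MeasurableSet (dilationFiltration exp b ν ϖ n) := by
  rw [dilationFiltration_eq exp b ν hϖ]
  exact ((isOpen_set_pi Set.finite_univ fun i _ => (isClopen_uniformizerBall ϖ _).isOpen).preimage
    (coordHomeomorph exp b).symm.continuous).measurableSet

/-- In the coordinates given by a graded basis, left translations are triangular. -/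
lemma leftTranslation_triangular [Group G] (𝒱 : LieGrading K 𝔤) {exp : 𝔤 ≃ₜ G}
    (hexp : IsLieExp K exp) (b : Module.Basis ι K 𝔤) {ν : ι → ℕ}
    (hb : ∀ i, b i ∈ 𝒱.V (ν i)) (g : G) (y y' : ι → K) (i : ι)
    (hy : ∀ j, ν j < ν i → y j = y' j) :
    (coordHomeomorph exp b).symm (g * coordHomeomorph exp b y) i - y i =
      (coordHomeomorph exp b).symm (g * coordHomeomorph exp b y') i - y' i := by
  have hbch : ∀ w, (coordHomeomorph exp b).symm (g * coordHomeomorph exp b w) =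
      b.equivFun (bchProduct K (exp.symm g) (b.equivFun.symm w)) := fun w => by
    have h := hexp (exp.symm g) (b.equivFun.symm w)
    rw [exp.apply_symm_apply] at h
    rw [coordHomeomorph_symm_apply, coordHomeomorph_apply, h, exp.symm_apply_apply]
  have hZ : b.equivFun.symm (y' - y) ∈ degreeFiltration b ν (ν i) := fun j hj => by
    rw [← b.equivFun_apply, LinearEquiv.apply_symm_apply, Pi.sub_apply, hy j hj, sub_self]
  have h := 𝒱.bchProduct_add_sub_mem b hb hexp (exp.symm g) (b.equivFun.symm y) hZ i
    (Nat.lt_succ_self _)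
  rw [← map_add, add_sub_cancel, ← b.equivFun_apply, map_sub, map_sub,
    LinearEquiv.apply_symm_apply, ← hbch, ← hbch] at h
  simp only [Pi.sub_apply] at h
  linear_combination -h

variable [MeasurableSpace G] [BorelSpace G] [Group G] [IsTopologicalGroup G]

/-- A Haar measure on `G` is a multiple of the image of the product measure in the coordinates of
the first kind, so `G_n` has measure `q ^ (-n Q)` times that of `G_0`. -/
lemma exists_measure_dilationFiltration (𝒱 : LieGrading K 𝔤) {exp : 𝔤 ≃ₜ G}
    (hexp : IsLieExp K exp) (b : Module.Basis ι K 𝔤) {ν : ι → ℕ}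
    (hb : ∀ i, b i ∈ 𝒱.V (ν i)) {ϖ : 𝒪[K]} (hϖ : Irreducible ϖ) (μ : Measure G)
    [μ.IsHaarMeasure] :
    ∃ C : ℝ, 0 < C ∧ ∀ n : ℤ, μ (dilationFiltration exp b ν ϖ n) =
      ENNReal.ofReal (C * ((Nat.card 𝓀[K] : ℝ) ^ (-n)) ^ 𝒱.homogeneousDim) := by
  let : MeasurableSpace K := borel K
  have : BorelSpace K := ⟨rfl⟩
  have := IsNonarchimedeanLocalField.secondCountableTopology K
  let E := coordHomeomorph exp b
  let lam : Measure K := Measure.addHaar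
  let pi : Measure (ι → K) := Measure.pi fun _ => lam
  have : LocallyCompactSpace G := E.symm.isClosedEmbedding.locallyCompactSpace
  have : SecondCountableTopology G := E.symm.secondCountableTopology
  have hinv : (Measure.map E pi).IsMulLeftInvariant := by
    refine ⟨fun g => ?_⟩
    have hcont : Continuous fun y => E.symm (g * E y) :=
      E.symm.continuous.comp (continuous_const.mul E.continuous)
    have hT : MeasurePreserving (fun y => E.symm (g * E y)) pi pi :=
      measurePreserving_of_triangular lam ν hcont.measurable
        (leftTranslation_triangular 𝒱 hexp b hb g)
    rw [Measure.map_map (measurable_const_mul g) E.continuous.measurable]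
    conv_rhs => rw [← hT.map_eq]
    rw [Measure.map_map E.continuous.measurable hT.measurable]
    congr 1
    funext y
    simp
  have hfin : IsFiniteMeasureOnCompacts (Measure.map E pi) :=
    Measure.IsFiniteMeasureOnCompacts.map pi E
  have hsmul := Measure.isMulLeftInvariant_eq_smul (Measure.map E pi) μ
  obtain ⟨c, hc⟩ : ∃ c, c = (Measure.map E pi).haarScalarFactor μ := ⟨_, rfl⟩
  rw [← hc] at hsmul
  have hq : (0 : ℝ) < Nat.card 𝓀[K] := by exact_mod_cast Finite.card_pos
  obtain ⟨m, hm⟩ : ∃ m, m = lam.real (uniformizerBall ϖ 0) := ⟨_, rfl⟩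
  have hmtop : lam (uniformizerBall ϖ 0) ≠ ∞ := (isCompact_uniformizerBall hϖ 0).measure_ne_top
  have hmeq : lam (uniformizerBall ϖ 0) = ENNReal.ofReal m := by
    rw [hm, Measure.real, ENNReal.ofReal_toReal hmtop]
  have hmpos : 0 < m := by
    rw [hm, Measure.real]
    refine ENNReal.toReal_pos ?_ hmtop
    refine ((isClopen_uniformizerBall ϖ 0).isOpen.measure_pos lam ⟨0, ?_⟩).ne'
    simp [uniformizerBall]
  have hbox : ∀ n : ℤ, c * μ (dilationFiltration exp b ν ϖ n) =
      ENNReal.ofReal (m ^ Fintype.card ι * ((Nat.card 𝓀[K] : ℝ) ^ (-n)) ^ 𝒱.homogeneousDim) := by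
    intro n
    have h1 : (Measure.map E pi) (dilationFiltration exp b ν ϖ n) =
        c * μ (dilationFiltration exp b ν ϖ n) := by
      rw [hsmul]; rfl
    rw [← h1, E.measurableEmbedding.map_apply, dilationFiltration_eq exp b ν hϖ,
      ← Set.preimage_comp]
    have hid : (coordHomeomorph exp b).symm ∘ E = id := by
      funext y
      exact E.symm_apply_apply y
    rw [hid, Set.preimage_id, Measure.pi_pi]
    rw [Finset.prod_congr rfl fun i _ => measure_uniformizerBall lam hϖ _, hmeq,
      Finset.prod_mul_distrib, Finset.prod_const, Finset.card_univ, mul_comm,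
      ← ENNReal.ofReal_prod_of_nonneg (fun i _ => (zpow_pos hq _).le),
      ← ENNReal.ofReal_pow hmpos.le, ← ENNReal.ofReal_mul (pow_pos hmpos _).le,
      𝒱.homogeneousDim_eq b hb, ← Finset.prod_pow_eq_pow_sum]
    congr 2
    refine Finset.prod_congr rfl fun i _ => ?_
    rw [← zpow_natCast, ← zpow_mul, neg_mul]
  have hcpos : 0 < c := by
    rw [pos_iff_ne_zero]
    rintro rfl
    have := hbox 0
    rw [ENNReal.coe_zero, zero_mul] at this
    exact (ENNReal.ofReal_pos.2 (by positivity)).ne this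
  refine ⟨m ^ Fintype.card ι / c, by positivity, fun n => ?_⟩
  have hcne : (c : ℝ≥0∞) ≠ 0 := by simpa using hcpos.ne'
  refine (ENNReal.mul_right_inj hcne ENNReal.coe_ne_top).1 ?_
  rw [hbox, ← ENNReal.ofReal_coe_nnreal, ← ENNReal.ofReal_mul c.coe_nonneg]
  congr 1
  have : (c : ℝ) ≠ 0 := by exact_mod_cast hcpos.ne'
  field_simp

theorem exists_isGeometricGauge (𝒱 : LieGrading K 𝔤) {exp : 𝔤 ≃ₜ G}
    (hexp : IsLieExp K exp) (b : Module.Basis ι K 𝔤) {ν : ι → ℕ}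
    (hb : ∀ i, b i ∈ 𝒱.V (ν i)) {ϖ : 𝒪[K]} (hϖ : Irreducible ϖ) (μ : Measure G)
    [μ.IsHaarMeasure] (hQ : 0 < 𝒱.homogeneousDim) :
    ∃ κ : ℝ, IsGeometricGauge μ
      (quasiNorm μ (dilationFiltration exp b ν ϖ) 𝒱.homogeneousDim) 𝒱.homogeneousDim
      (Nat.card 𝓀[K]) κ := by
  obtain ⟨C, hC, hμ⟩ := exists_measure_dilationFiltration 𝒱 hexp b hb hϖ μ
  refine ⟨C ^ (1 / (𝒱.homogeneousDim : ℝ)), isGeometricGauge_quasiNorm (by exact_mod_cast hQ)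
    (by exact_mod_cast one_lt_natCard_residueField) (Real.rpow_pos_of_pos hC _)
    (measurableSet_dilationFiltration exp b ν hϖ) (antitone_dilationFiltration exp b ν hϖ)
    (exists_mem_dilationFiltration exp b
      (fun i => (Finset.mem_Icc.1 (𝒱.degree_mem b hb i)).1) hϖ) fun n => ?_⟩
  rw [hμ, Real.rpow_natCast, mul_pow, one_div, Real.rpow_inv_natCast_pow hC.le hQ.ne']

end GradedGroup

/-! ### The norm of the Hardy operator on a graded group -/

theorem mainTheorem2
    {K : Type*} [Field K] [ValuativeRel K] [TopologicalSpace K] [IsNonarchimedeanLocalField K]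
    {𝔤 : Type*} [LieRing 𝔤] [LieAlgebra K 𝔤] [LieRing.IsNilpotent 𝔤]
    [TopologicalSpace 𝔤] [IsModuleTopology K 𝔤]
    (hchar : ∀ n : ℕ, 1 ≤ n → n ≤ LieModule.nilpotencyLength 𝔤 𝔤 → (n : K) ≠ 0)
    (𝒱 : LieGrading K 𝔤)
    {G : Type*} [Group G] [TopologicalSpace G] [IsTopologicalGroup G]
    [MeasurableSpace G] [BorelSpace G]
    (exp : 𝔤 ≃ₜ G) (hexp : IsLieExp K exp)
    {ι : Type*} [Fintype ι] (b : Module.Basis ι K 𝔤) (ν : ι → ℕ) (hb : ∀ i, b i ∈ 𝒱.V (ν i))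
    (ϖ : 𝒪[K]) (hϖ : Irreducible ϖ)
    (μ : Measure G) [μ.IsHaarMeasure]
    (Q : ℕ) (hQ : Q = 𝒱.homogeneousDim) (q : ℕ) (hq : q = Nat.card 𝓀[K])
    (N : G → ℝ) (hN : N = quasiNorm μ (dilationFiltration exp b ν ϖ) Q)
    {𝕜 : Type*} [RCLike 𝕜]
    (r r' α δ : ℝ) (hr : 1 < r) (hr' : 1 / r + 1 / r' = 1) [Fact (1 ≤ ENNReal.ofReal r)]
    (hδ : 0 ≤ δ) (hδQ : δ < Q) (hα : α < (r - 1) * Q - δ * r) :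
    (∀ f : Lp 𝕜 (ENNReal.ofReal r) (powerWeight μ N (α + δ * r)),
      ∀ x : G, IntegrableOn f {t | N t ≤ N x} μ) ∧
    ∃ H : Lp 𝕜 (ENNReal.ofReal r) (powerWeight μ N (α + δ * r)) →L[𝕜]
        Lp 𝕜 (ENNReal.ofReal r) (powerWeight μ N α),
      (∀ f, H f =ᵐ[μ] hardy μ N Q δ f) ∧
      ‖H‖ = ‖H.comp (radialLp 𝕜 (ENNReal.ofReal r) (powerWeight μ N (α + δ * r)) N).subtypeL‖ ∧
      ‖H‖ = (1 - (q : ℝ) ^ (-(Q : ℝ))) / (1 - (q : ℝ) ^ (α / r - Q / r' + δ)) := by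
  have hQpos : 0 < Q := by exact_mod_cast hδ.trans_lt hδQ
  obtain ⟨κ, hgauge⟩ := exists_isGeometricGauge 𝒱 hexp b hb hϖ μ (hQ ▸ hQpos)
  rw [← hQ, ← hq, ← hN] at hgauge
  have : SecondCountableTopology K := IsNonarchimedeanLocalField.secondCountableTopology K
  have : SecondCountableTopology G := (coordHomeomorph exp b).symm.secondCountableTopology
  have : LocallyCompactSpace G :=
    (coordHomeomorph exp b).symm.isClosedEmbedding.locallyCompactSpace
  have hr0 : 0 < r := by linarith
  -- `θ = Q / r' - α / r - δ`, so that `q ^ (-θ)` is the ratio of the geometric series.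
  obtain ⟨θ, hθ⟩ : ∃ θ, θ = ((r - 1) * Q - δ * r - α) / r := ⟨_, rfl⟩
  have hθ0 : 0 < θ := hθ ▸ div_pos (by linarith) hr0
  have hexponent : α + δ * r = (Q - θ) * r - Q := by
    rw [hθ]; field_simp; ring
  have hratio : α / r - Q / r' + δ = -θ := by
    have h1 : 1 / r' = 1 - 1 / r := by linarith
    rw [div_eq_mul_one_div (Q : ℝ) r', h1, hθ]
    field_simp
    ring
  rw [hratio]
  refine ⟨?_, hgauge.exists_hardy_clm_norm_eq hr hθ0 hexponent⟩
  rw [hexponent]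
  exact hgauge.integrableOn_ball hr hθ0
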